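/- Notation. For real $\lambda,\mu$, let $S(\lambda,\mu)(\mathbb{R}^d)$ be the space of functions $\varphi\in C^\infty(\mathbb{R}^d,\mathbb{C})$ for which there are constants $A>0$ and $M\ge 0$ with $$|x^\alpha\partial^\beta\varphi(x)|\le M\,A^{|\alpha|+|\beta|}(\alpha!)^\lambda(\beta!)^\mu\qquad\text{for all multi-indices }\alpha,\beta\text{ and all }x\in\mathbb{R}^d .$$ For fixed $A$ these functions form a normed space $S_A$, normed by the least $M$, and $S(\lambda,\mu)(\mathbb{R}^d)=\bigcup_{A>0}S_A$ carries the locally convex inductive limit topology. On the Schwartz space $\mathcal{S}(\mathbb{R}^d)$, $e^{\Delta/(8\pi)}$ is the injective operator with Fourier multiplier $e^{-\pi|\xi|^2/2}$, for the Fourier transform $\int u(x)e^{-2i\pi x\cdot\xi}\,dx$. Its range $e^{\Delta/(8\pi)}\mathcal{S}(\mathbb{R}^d)$ carries the topology of $\mathcal{S}(\mathbb{R}^d)$ transported by this operator. Theorem. Let $n\ge 0$ be an integer. (1) If $\lambda>0$ and $0<\mu<\frac12$, then $S(\lambda,\mu)(\mathbb{R}^n)\subset e^{\Delta/(8\pi)}\mathcal{S}(\mathbb{R}^n)$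 and the inclusion is continuous. In other words, every $\varphi\in S(\lambda,\mu)(\mathbb{R}^n)$ is $e^{\Delta/(8\pi)}\Phi$ for some $\Phi\in\mathcal{S}(\mathbb{R}^n)$, and the map $\varphi\mapsto\Phi$ is linear and continuous from $S(\lambda,\mu)(\mathbb{R}^n)$ to $\mathcal{S}(\mathbb{R}^n)$. (2) Let $A:\mathcal{S}(\mathbb{R}^n)\to\mathcal{S}'(\mathbb{R}^n)$ be a continuous linear operator, where $\mathcal{S}'(\mathbb{R}^n)$ carries the topology of pointwise convergence. Then $A$ has a unique Weyl symbol $\sigma\in\mathcal{S}'(\mathbb{R}^{2n})$, that is, $$\sigma(x,\xi)=\int_{\mathbb{R}^n}e^{-2i\pi t\cdot\xi}K_A\left(x+\tfrac t2,x-\tfrac t2\right)dt$$ in the sense of tempered distributions, where $K_A\in\mathcal{S}'(\mathbb{R}^{2n})$ is the distribution kernel of $A$. There is a unique linear form $T(A)$ on $e^{\Delta/(8\pi)}\mathcal{S}(\mathbb{R}^{2n})$, the anti-Wick symbol of $A$, with $\langle T(A),e^{\Delta/(8\pi)}\Phi\rangle=\langle\sigma,\Phi\rangle$ for all $\Phi\in\mathcal{S}(\mathbb{R}^{2n})$.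 For all $\lambda>0$ and $\mu<\frac12$, the space $S(\lambda,\mu)(\mathbb{R}^{2n})$ is contained in $e^{\Delta/(8\pi)}\mathcal{S}(\mathbb{R}^{2n})$, and the restriction of $T(A)$ to $S(\lambda,\mu)(\mathbb{R}^{2n})$ is a continuous linear form; that is, $T(A)$ is a Gelfand–Shilov generalized function. -/

import Mathlib

open scoped SchwartzMap ContDiff

noncomputable section

namespace AntiWick

/-- The Euclidean space `ℝ^d`. -/
abbrev Rn (d : ℕ) : Type := EuclideanSpace ℝ (Fin d)

/-! ### The heat semigroup on Schwartz functions and the space `e^{tΔ} 𝓢(ℝ^d)` -/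

/-- The multiplier `ξ ↦ exp (-4 π² t |ξ|²)` of `e^{tΔ}`, for the Fourier transform
`∫ u(x) exp (-2 i π x·ξ) dx`, in which `Δ` has the multiplier `-4 π² |ξ|²`. -/
def heatMultiplier (d : ℕ) (t : ℝ) (ξ : Rn d) : ℂ :=
  ((Real.exp (-(4 * Real.pi ^ 2 * t * ‖ξ‖ ^ 2)) : ℝ) : ℂ)

/-- For `t ≥ 0` the multiplier has temperate growth, so that `heat d t` below is a genuine
Fourier multiplier operator. -/
theorem heatMultiplier_hasTemperateGrowth (d : ℕ) {t : ℝ} (ht : 0 ≤ t) :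
    (heatMultiplier d t).HasTemperateGrowth := by
  have key : (fun ξ : Rn d => Real.exp (-(4 * Real.pi ^ 2 * t * ‖ξ‖ ^ 2))).HasTemperateGrowth := by
    set c : ℝ := 4 * Real.pi ^ 2 * t with hc
    have hc0 : 0 ≤ c := by positivity
    have hcd : ContDiff ℝ ∞ (fun s : ℝ => Real.exp (-c * s)) := by fun_prop
    have := Function.HasTemperateGrowth.comp' (g := fun s : ℝ => Real.exp (-c * s))
      (f := fun ξ : Rn d => ‖ξ‖ ^ 2) (t := Set.Ici (0 : ℝ))
      (by rintro _ ⟨x, rfl⟩; exact Set.mem_Ici.2 (by positivity)) (uniqueDiffOn_Ici 0)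
      hcd.contDiffOn
      (by
        intro N
        refine ⟨0, ∑ n ∈ Finset.range (N + 1), c ^ n, Finset.sum_nonneg fun n _ => by positivity,
          fun n hn x hx => ?_⟩
        rw [iteratedFDerivWithin_eq_iteratedFDeriv (uniqueDiffOn_Ici 0)
          ((hcd.of_le (mod_cast le_top)).contDiffAt) hx,
          norm_iteratedFDeriv_eq_norm_iteratedDeriv, iteratedDeriv_exp_const_mul]
        have h1 : Real.exp (-c * x) ≤ 1 := by
          rw [Real.exp_le_one_iff]
          have : 0 ≤ c * x := mul_nonneg hc0 hx
          linarith
        have h2 : c ^ n ≤ ∑ n ∈ Finset.range (N + 1), c ^ n :=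
          Finset.single_le_sum (f := fun n => c ^ n) (fun n _ => by positivity)
            (Finset.mem_range.2 (by omega))
        rw [norm_mul, norm_pow, norm_neg, Real.norm_of_nonneg hc0,
          Real.norm_of_nonneg (Real.exp_pos _).le, pow_zero, mul_one]
        have h3 : 0 ≤ c ^ n := by positivity
        nlinarith)
      (Function.hasTemperateGrowth_norm_sq (Rn d))
    have heq : ((fun s : ℝ => Real.exp (-c * s)) ∘ fun ξ : Rn d => ‖ξ‖ ^ 2) =
        fun ξ : Rn d => Real.exp (-(c * ‖ξ‖ ^ 2)) := by
      funext ξ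
      simp [neg_mul]
    rwa [heq] at this
  exact Function.Complex.hasTemperateGrowth_ofReal.comp key

/-- The operator `e^{tΔ}` on `𝓢(ℝ^d)`. -/
def heat (d : ℕ) (t : ℝ) : 𝓢(Rn d, ℂ) →L[ℂ] 𝓢(Rn d, ℂ) :=
  SchwartzMap.fourierMultiplierCLM ℂ (heatMultiplier d t)

theorem heat_injective (d : ℕ) {t : ℝ} (ht : 0 ≤ t) : Function.Injective (heat d t) := by
  intro f g hfg
  have h : SchwartzMap.smulLeftCLM ℂ (heatMultiplier d t) (FourierTransform.fourier f) =
      SchwartzMap.smulLeftCLM ℂ (heatMultiplier d t) (FourierTransform.fourier g) := by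
    have := congrArg FourierTransform.fourier hfg
    simpa [heat, SchwartzMap.fourierMultiplierCLM_apply] using this
  have h2 : FourierTransform.fourier f = FourierTransform.fourier g := by
    ext ξ
    have h3 := congrArg (fun u : 𝓢(Rn d, ℂ) => u ξ) h
    simp only [SchwartzMap.smulLeftCLM_apply_apply (heatMultiplier_hasTemperateGrowth d ht),
      smul_eq_mul] at h3
    refine mul_left_cancel₀ ?_ h3
    exact Complex.ofReal_ne_zero.2 (Real.exp_pos _).ne'
  have h4 := congrArg FourierTransformInv.fourierInv h2
  simpa using h4

/-- `Φ ↦ e^{tΔ} Φ`, as a linear map from `𝓢(ℝ^d)` to functions on `ℝ^d`. -/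
def heatFun (d : ℕ) (t : ℝ) : 𝓢(Rn d, ℂ) →ₗ[ℂ] (Rn d → ℂ) where
  toFun Φ := heat d t Φ
  map_add' Φ Ψ := by funext x; simp
  map_smul' c Φ := by funext x; simp

/-- The vector space `e^{tΔ} 𝓢(ℝ^d)` of functions on `ℝ^d`. -/
def heatImage (d : ℕ) (t : ℝ) : Submodule ℂ (Rn d → ℂ) := LinearMap.range (heatFun d t)

/-- The elements of `e^{tΔ} 𝓢(ℝ^d)`; a type of its own, so that it does not carry the topology of
pointwise convergence. -/
def HeatSpace (d : ℕ) (t : ℝ) : Type := ↥(heatImage d t)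

instance (d : ℕ) (t : ℝ) : AddCommGroup (HeatSpace d t) :=
  inferInstanceAs (AddCommGroup ↥(heatImage d t))

instance (d : ℕ) (t : ℝ) : Module ℂ (HeatSpace d t) :=
  inferInstanceAs (Module ℂ ↥(heatImage d t))

/-- `Φ ↦ e^{tΔ} Φ`, as a map from `𝓢(ℝ^d)` onto `e^{tΔ} 𝓢(ℝ^d)`. -/
def toHeatSpace (d : ℕ) (t : ℝ) : 𝓢(Rn d, ℂ) →ₗ[ℂ] HeatSpace d t := (heatFun d t).rangeRestrict

/-- For `t ≥ 0` the map `toHeatSpace d t` is bijective, so that the topology below is the topology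
of `𝓢(ℝ^d)` transported by it. -/
theorem toHeatSpace_bijective (d : ℕ) {t : ℝ} (ht : 0 ≤ t) :
    Function.Bijective (toHeatSpace d t) := by
  refine ⟨fun f g hfg => heat_injective d ht ?_, LinearMap.surjective_rangeRestrict _⟩
  exact DFunLike.coe_injective (congrArg Subtype.val hfg)

instance (d : ℕ) (t : ℝ) : TopologicalSpace (HeatSpace d t) :=
  TopologicalSpace.coinduced (toHeatSpace d t) inferInstance

/-! ### The Gelfand-Shilov spaces -/

/-- `∂^β φ (x)`: the derivative of order `|β|` of `φ` at `x`, evaluated at `β 0` copies of the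
first basis vector, followed by `β 1` copies of the second one, and so on. -/
def multiDeriv {d : ℕ} (β : Fin d → ℕ) (φ : Rn d → ℂ) (x : Rn d) : ℂ :=
  iteratedFDeriv ℝ (∑ i, β i) φ x
    (fun k => EuclideanSpace.single (finSigmaFinEquiv.symm k).1 (1 : ℝ))

/-- `|x^α ∂^β φ(x)| ≤ M A^{|α| + |β|} (α!)^lam (β!)^mu` for all `α`, `β` and `x`. -/
def GSBound {d : ℕ} (lam mu A M : ℝ) (φ : Rn d → ℂ) : Prop :=
  ∀ (α β : Fin d → ℕ) (x : Rn d),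
    |∏ i, x i ^ α i| * ‖multiDeriv β φ x‖ ≤
      M * A ^ (∑ i, α i + ∑ i, β i) *
        ((∏ i, (α i).factorial : ℕ) : ℝ) ^ lam * ((∏ i, (β i).factorial : ℕ) : ℝ) ^ mu

theorem multiDeriv_add {d : ℕ} (β : Fin d → ℕ) {φ ψ : Rn d → ℂ} (hφ : ContDiff ℝ ∞ φ)
    (hψ : ContDiff ℝ ∞ ψ) (x : Rn d) :
    multiDeriv β (φ + ψ) x = multiDeriv β φ x + multiDeriv β ψ x := by
  unfold multiDeriv
  rw [iteratedFDeriv_add_apply (hφ.of_le (mod_cast le_top)).contDiffAt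
    (hψ.of_le (mod_cast le_top)).contDiffAt]
  rfl

theorem multiDeriv_smul {d : ℕ} (β : Fin d → ℕ) (c : ℂ) {φ : Rn d → ℂ} (hφ : ContDiff ℝ ∞ φ)
    (x : Rn d) : multiDeriv β (c • φ) x = c * multiDeriv β φ x := by
  unfold multiDeriv
  rw [iteratedFDeriv_const_smul_apply (hφ.of_le (mod_cast le_top)).contDiffAt]
  rfl

theorem GSBound.nonneg {d : ℕ} {lam mu A M : ℝ} {φ : Rn d → ℂ} (h : GSBound lam mu A M φ) :
    0 ≤ M := by
  have := h 0 0 0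
  simp only [Pi.zero_apply, pow_zero, Finset.prod_const_one, abs_one, one_mul,
    Finset.sum_const_zero, add_zero, Nat.factorial_zero, Nat.cast_one, Real.one_rpow,
    mul_one] at this
  exact (norm_nonneg _).trans this

theorem GSBound.mono {d : ℕ} {lam mu A B M : ℝ} {φ : Rn d → ℂ} (hA : 0 < A) (hAB : A ≤ B)
    (h : GSBound lam mu A M φ) : GSBound lam mu B M φ := by
  intro α β x
  have hM := h.nonneg
  refine (h α β x).trans ?_
  gcongr

theorem GSBound.add {d : ℕ} {lam mu A M N : ℝ} {φ ψ : Rn d → ℂ} (hφ : ContDiff ℝ ∞ φ)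
    (hψ : ContDiff ℝ ∞ ψ) (h : GSBound lam mu A M φ) (k : GSBound lam mu A N ψ) :
    GSBound lam mu A (M + N) (φ + ψ) := by
  intro α β x
  rw [multiDeriv_add β hφ hψ, add_mul, add_mul, add_mul]
  refine le_trans ?_ (add_le_add (h α β x) (k α β x))
  rw [← mul_add]
  exact mul_le_mul_of_nonneg_left (norm_add_le _ _) (abs_nonneg _)

theorem GSBound.smul {d : ℕ} {lam mu A M : ℝ} {φ : Rn d → ℂ} (c : ℂ) (hφ : ContDiff ℝ ∞ φ)
    (h : GSBound lam mu A M φ) : GSBound lam mu A (‖c‖ * M) (c • φ) := by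
  intro α β x
  rw [multiDeriv_smul β c hφ, norm_mul, mul_left_comm, mul_assoc ‖c‖, mul_assoc ‖c‖,
    mul_assoc ‖c‖]
  exact mul_le_mul_of_nonneg_left (h α β x) (norm_nonneg _)

/-- The Gelfand-Shilov space `S(lam, mu)(ℝ^d)`. -/
def gelfandShilov (d : ℕ) (lam mu : ℝ) : Submodule ℂ (Rn d → ℂ) where
  carrier := {φ | ContDiff ℝ ∞ φ ∧ ∃ A M : ℝ, 0 < A ∧ GSBound lam mu A M φ}
  zero_mem' := by
    refine ⟨contDiff_const, 1, 0, one_pos, fun α β x => ?_⟩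
    simp [multiDeriv]
  add_mem' := by
    rintro φ ψ ⟨hφ, A, M, hA, h⟩ ⟨hψ, B, N, hB, k⟩
    exact ⟨hφ.add hψ, max A B, M + N, lt_max_of_lt_left hA,
      (h.mono hA (le_max_left A B)).add hφ hψ (k.mono hB (le_max_right A B))⟩
  smul_mem' := by
    rintro c φ ⟨hφ, A, M, hA, h⟩
    exact ⟨hφ.const_smul c, A, ‖c‖ * M, hA, h.smul c hφ⟩

/-- The elements of `S(lam, mu)(ℝ^d)`; a type of its own, so that it does not carry the topology of
pointwise convergence. -/
def GelfandShilov (d : ℕ) (lam mu : ℝ) : Type := ↥(gelfandShilov d lam mu)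

instance (d : ℕ) (lam mu : ℝ) : AddCommGroup (GelfandShilov d lam mu) :=
  inferInstanceAs (AddCommGroup ↥(gelfandShilov d lam mu))

instance (d : ℕ) (lam mu : ℝ) : Module ℂ (GelfandShilov d lam mu) :=
  inferInstanceAs (Module ℂ ↥(gelfandShilov d lam mu))

/-- The seminorms on `S(lam, mu)(ℝ^d)` whose restriction to each of the spaces `S_A`, `A > 0`, is
continuous. Here `S_A` is the space of the `φ` that satisfy `GSBound lam mu A M φ` for some `M`,
normed by the least such `M`; `S(lam, mu)(ℝ^d)` is the union of the `S_A`. -/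
def GSSeminorm (d : ℕ) (lam mu : ℝ) : Type :=
  {p : Seminorm ℂ (GelfandShilov d lam mu) // ∀ A : ℝ, 0 < A → ∃ C : ℝ,
    ∀ (φ : GelfandShilov d lam mu) (M : ℝ), GSBound lam mu A M φ.1 → p φ ≤ C * M}

instance (d : ℕ) (lam mu : ℝ) : Nonempty (GSSeminorm d lam mu) :=
  ⟨⟨0, fun _ _ => ⟨0, fun _ _ _ => by simp⟩⟩⟩

def gsSeminormFamily (d : ℕ) (lam mu : ℝ) :
    SeminormFamily ℂ (GelfandShilov d lam mu) (GSSeminorm d lam mu) := fun p => p.1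

/-- The locally convex inductive limit topology of `S(lam, mu)(ℝ^d) = ⋃ S_A`: the finest locally
convex topology for which all the inclusions of the normed spaces `S_A` are continuous. -/
instance (d : ℕ) (lam mu : ℝ) : TopologicalSpace (GelfandShilov d lam mu) :=
  (gsSeminormFamily d lam mu).moduleFilterBasis.topology

theorem gelfandShilov_withSeminorms (d : ℕ) (lam mu : ℝ) :
    WithSeminorms (gsSeminormFamily d lam mu) := ⟨rfl⟩

/-- The inclusion map of `S(lam, mu)(ℝ^d)` in `e^{tΔ} 𝓢(ℝ^d)`, when one space is contained in the
other. -/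
def gsInclusion {d : ℕ} {lam mu t : ℝ} (h : gelfandShilov d lam mu ≤ heatImage d t) :
    GelfandShilov d lam mu →ₗ[ℂ] HeatSpace d t := Submodule.inclusion h

/-! ### Kernel, Weyl symbol and anti-Wick symbol of an operator `𝓢(ℝ^n) → 𝓢'(ℝ^n)` -/

/-- The point `(x, y)` of `ℝ^{2n}`. -/
def pair {n : ℕ} (x y : Rn n) : Rn (n + n) := WithLp.toLp 2 (Fin.append x y)

/-- `K` is the distribution kernel of `A`: `⟨A f, g⟩ = ⟨K, g ⊗ f⟩`, that is, formally,
`(A f)(x) = ∫ K(x, y) f(y) dy`. -/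
def IsKernel {n : ℕ} (A : 𝓢(Rn n, ℂ) →L[ℂ] 𝓢'(Rn n, ℂ)) (K : 𝓢'(Rn (n + n), ℂ)) : Prop :=
  ∀ (f g : 𝓢(Rn n, ℂ)) (F : 𝓢(Rn (n + n), ℂ)), (∀ x y, F (pair x y) = g x * f y) → A f g = K F

/-- `σ(x, ξ) = ∫ exp (-2 i π t·ξ) K(x + t/2, x - t/2) dt` in the sense of tempered distributions:
integration against `Φ(x, ξ)` and the change of variables `(x + t/2, x - t/2) = (u, v)` give
`⟨σ, Φ⟩ = ⟨K, F⟩` with the Schwartz function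
`F(u, v) = ∫ exp (-2 i π (u - v)·ξ) Φ((u + v)/2, ξ) dξ`. -/
def IsWeylTransform {n : ℕ} (K σ : 𝓢'(Rn (n + n), ℂ)) : Prop :=
  ∀ Φ F : 𝓢(Rn (n + n), ℂ),
    (∀ u v : Rn n, F (pair u v) =
      ∫ ξ : Rn n, Complex.exp (-(2 * Real.pi * (inner ℝ (u - v) ξ : ℝ) : ℝ) * Complex.I) *
        Φ (pair ((1 / 2 : ℝ) • (u + v)) ξ)) →
    σ Φ = K F

/-- `σ` is the Weyl symbol of `A`. -/
def IsWeylSymbol {n : ℕ} (A : 𝓢(Rn n, ℂ) →L[ℂ] 𝓢'(Rn n, ℂ)) (σ : 𝓢'(Rn (n + n), ℂ)) : Prop :=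
  ∃ K : 𝓢'(Rn (n + n), ℂ), IsKernel A K ∧ IsWeylTransform K σ

/-- `T` is the anti-Wick symbol of `A`, as a linear form on `e^{Δ/(8π)} 𝓢(ℝ^{2n})`:
`⟨T, e^{Δ/(8π)} Φ⟩ = ⟨σ, Φ⟩` for `Φ ∈ 𝓢(ℝ^{2n})`, where `σ` is the Weyl symbol of `A`. -/
def IsAntiWickSymbol {n : ℕ} (A : 𝓢(Rn n, ℂ) →L[ℂ] 𝓢'(Rn n, ℂ))
    (T : HeatSpace (n + n) (1 / (8 * Real.pi)) →ₗ[ℂ] ℂ) : Prop :=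
  ∃ σ : 𝓢'(Rn (n + n), ℂ), IsWeylSymbol A σ ∧
    ∀ Φ : 𝓢(Rn (n + n), ℂ), T (toHeatSpace (n + n) (1 / (8 * Real.pi)) Φ) = σ Φ

end AntiWick

end

open AntiWick

/-! Both parts rest on inverting the heat operator on Gelfand–Shilov functions. With `t = 1/(8π)`,
put `Φ = ∑ (-t)^j Δ^j φ / j!`. The multi-index bounds give `‖x‖^k ‖D^l Δ^j φ(x)‖ ≤ M C^(j+1)
((l+2j)!)^(max mu 0)` with `C` independent of `φ` and `j`. Since `(2j)!` grows like `(j!)^2` up to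
geometric factors, after division by `j!` the terms are summable exactly because `mu < 1/2`. So the
series converges in the Schwartz space, with bounds linear in `M`, which is continuity for the
inductive limit topology. On the Fourier side the series is the exponential series of `4π²t|ξ|²`,
which cancels the heat multiplier (`heat_eq_of_hasSum_invHeatTerm`). The anti-Wick symbol restricted
to `S(lam, mu)` is then `σ ∘ e^{-tΔ}`, a composition of continuous maps.

The Weyl symbol needs the Schwartz kernel theorem, obtained from a Gabor-type expansion. A partition
of unity by small translates localises `f`, and each piece is expanded in a Fourier series on a unit
cube: `f = ∑ gaborCoef i f • gaborAtom i`. The coefficients decay faster than any power of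
`gaborWeight i`, while the seminorms of the atoms grow at most polynomially. Hence polynomially
bounded data on the atoms define continuous functionals and operators. Atoms of `ℝ^{2n}` are tensor
products of atoms of `ℝ^n`, so the numbers `A (gaborAtom i) (gaborAtom j)` define the kernel once
they are bounded polynomially in both indices; this bound comes from the Baire category theorem
(`exists_norm_operator_gaborAtom_le`). The same expansion gives the partial Fourier transform, hence
the continuous map from test functions of `σ` to test functions of the kernel. -/

/-! ### Absolutely convergent series of Schwartz functions -/

section Series

open scoped Topology
open Filter

variable {E F ι : Type*} [NormedAddCommGroup E] [NormedSpace ℝ E] [NormedAddCommGroup F]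
  [NormedSpace ℝ F]

/-- A series of Schwartz functions that converges absolutely for each Schwartz seminorm
converges. -/
theorem SchwartzMap.summable_of_summable_seminorm [CompleteSpace F] {g : ι → 𝓢(E, F)}
    (hg : ∀ k l, Summable fun i => SchwartzMap.seminorm ℝ k l (g i)) : Summable g := by
  have hbd : ∀ (l : ℕ) (i : ι) (x : E), ‖iteratedFDeriv ℝ l (g i) x‖ ≤
      SchwartzMap.seminorm ℝ 0 l (g i) := fun l i x => norm_iteratedFDeriv_le_seminorm ℝ _ _ _
  have hts : ∀ (s : Set ι) (l : ℕ) (x : E),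
      iteratedFDeriv ℝ l (fun y => ∑' i : s, g i y) x = ∑' i : s, iteratedFDeriv ℝ l (g i) x :=
    fun s l x => iteratedFDeriv_tsum_apply (𝕜 := ℝ) (N := ⊤)
      (f := fun (i : s) y => g i y)
      (v := fun l (i : s) => SchwartzMap.seminorm ℝ 0 l (g i)) (fun i => (g i).smooth _)
      (fun l _ => (hg 0 l).subtype s) (fun l i x _ => hbd l i x) le_top x
  have hsm : ∀ s : Set ι, ContDiff ℝ ∞ fun y => ∑' i : s, g i y := fun s =>
    contDiff_tsum (𝕜 := ℝ) (N := ⊤) (f := fun (i : s) y => g i y)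
      (v := fun l (i : s) => SchwartzMap.seminorm ℝ 0 l (g i)) (fun i => (g i).smooth _)
      (fun l _ => (hg 0 l).subtype s) (fun l i x _ => hbd l i x)
  have hdec : ∀ (s : Set ι) (k l : ℕ) (x : E),
      ‖x‖ ^ k * ‖iteratedFDeriv ℝ l (fun y => ∑' i : s, g i y) x‖ ≤
        ∑' i : s, SchwartzMap.seminorm ℝ k l (g i) := by
    intro s k l x
    rw [hts s l x]
    have hs : Summable fun i : s => ‖iteratedFDeriv ℝ l (g i) x‖ :=
      Summable.of_nonneg_of_le (fun _ => norm_nonneg _) (fun i => hbd l i x)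
        ((hg 0 l).subtype s)
    refine (mul_le_mul_of_nonneg_left (norm_tsum_le_tsum_norm hs) (by positivity)).trans ?_
    rw [← tsum_mul_left]
    exact (hs.mul_left _).tsum_le_tsum (fun i => le_seminorm ℝ k l (g i) x)
      ((hg k l).subtype s)
  -- Sums over arbitrary subsets are built at once, so that the remainder after a finite partial sum
  -- is itself a Schwartz function, with seminorms bounded by the tails of the given series.
  let G : Set ι → 𝓢(E, F) := fun s => ⟨fun y => ∑' i : s, g i y, hsm s, fun k l => ⟨_, hdec s k l⟩⟩
  have hsumx : ∀ x, Summable fun i => g i x := fun x =>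
    Summable.of_norm_bounded (hg 0 0) fun i => norm_le_seminorm ℝ (g i) x
  refine ⟨G Set.univ, ?_⟩
  rw [HasSum, SummationFilter.unconditional_filter,
    (schwartz_withSeminorms ℝ E F).tendsto_nhds]
  rintro ⟨k, l⟩ ε hε
  have htail := tendsto_tsum_compl_atTop_zero fun i => SchwartzMap.seminorm ℝ k l (g i)
  filter_upwards [htail.eventually (gt_mem_nhds hε)] with s hs
  have hGs : (∑ i ∈ s, g i) - G Set.univ = -G {i | i ∉ s} := by
    ext x
    have h1 := (hsumx x).sum_add_tsum_compl (s := s)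
    have h2 : (G Set.univ) x = ∑' i, g i x := tsum_univ fun i => g i x
    have h3 : (∑ i ∈ s, g i) x = ∑ i ∈ s, g i x := by simp
    have h4 : (G {i | i ∉ s}) x = ∑' i : ↑((s : Set ι)ᶜ), g i x := rfl
    rw [sub_apply, neg_apply, h2, h3, h4, ← h1]
    abel
  rw [hGs, map_neg_eq_map]
  refine lt_of_le_of_lt ?_ hs
  exact SchwartzMap.seminorm_le_bound ℝ k l _
    (tsum_nonneg fun i => apply_nonneg (SchwartzMap.seminorm ℝ k l) _) (hdec _ k l)

/-- A continuous seminorm of the sum of a series is at most the sum of the seminorms. -/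
theorem Seminorm.le_tsum_of_hasSum {𝕜 V : Type*} [NormedField 𝕜] [AddCommGroup V] [Module 𝕜 V]
    [TopologicalSpace V] {p : Seminorm 𝕜 V} (hp : Continuous p) {g : ι → V} {f : V}
    (h : HasSum g f) (hs : Summable fun i => p (g i)) : p f ≤ ∑' i, p (g i) := by
  refine le_of_tendsto ((hp.tendsto f).comp h) (Eventually.of_forall fun s => ?_)
  refine (Finset.le_sum_of_subadditive p (map_zero p).le (map_add_le_add p) s g).trans ?_
  exact hs.sum_le_tsum s fun i _ => apply_nonneg p _

end Series

/-! ### Completeness and the Baire property of the Schwartz space -/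

section Complete

open scoped Topology Uniformity
open Filter

variable {E F : Type*} [NormedAddCommGroup E] [NormedSpace ℝ E] [NormedAddCommGroup F]
  [NormedSpace ℝ F]

instance SchwartzMap.isCountablyGenerated_uniformity : (𝓤 𝓢(E, F)).IsCountablyGenerated :=
  IsUniformAddGroup.uniformity_countably_generated

instance SchwartzMap.completeSpace [CompleteSpace F] : CompleteSpace 𝓢(E, F) := by
  let p : ℕ → Seminorm ℝ 𝓢(E, F) := fun N =>
    (Finset.Iic (N, N)).sup (schwartzSeminormFamily ℝ E F)
  have hle : ∀ {k l N : ℕ}, k ≤ N → l ≤ N → ∀ f, SchwartzMap.seminorm ℝ k l f ≤ p N f :=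
    fun {k l N} hk hl f => Seminorm.le_def.1
      (Finset.le_sup (f := schwartzSeminormFamily ℝ E F)
        (Finset.mem_Iic.2 (Prod.mk_le_mk.2 ⟨hk, hl⟩))) f
  refine UniformSpace.complete_of_convergent_controlled_sequences
    (fun N => {x | p N (x.2 - x.1) < (1 / 2) ^ N}) (fun N => ?_) fun u hu => ?_
  · rw [uniformity_eq_comap_nhds_zero]
    refine ⟨(p N).ball 0 ((1 / 2) ^ N), ?_, fun x hx => (p N).mem_ball_zero.1 hx⟩
    exact (schwartz_withSeminorms ℝ E F).hasBasis_zero_ball.mem_of_mem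
      (i := (Finset.Iic (N, N), (1 / 2) ^ N)) (by positivity)
  -- A controlled sequence has consecutive differences below `2^(-N)` for `p N`, so its telescoping
  -- series converges. A given seminorm is dominated by `p N` only once `N ≥ max k l`, hence the
  -- eventual bound.
  · have hsum : Summable fun N => u (N + 1) - u N := by
      refine SchwartzMap.summable_of_summable_seminorm fun k l => ?_
      refine Summable.of_norm_bounded_eventually_nat summable_geometric_two ?_
      filter_upwards [eventually_ge_atTop (max k l)] with N hN
      rw [Real.norm_of_nonneg (apply_nonneg _ _)]
      exact (hle (le_of_max_le_left hN) (le_of_max_le_right hN) _).trans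
        (hu N N (N + 1) le_rfl (Nat.le_succ N)).le
    obtain ⟨f, hf⟩ := hsum
    refine ⟨f + u 0, ?_⟩
    have := (hf.tendsto_sum_nat).add_const (u 0)
    simpa only [Finset.sum_range_sub u, sub_add_cancel] using this

instance SchwartzMap.baireSpace [CompleteSpace F] : BaireSpace 𝓢(E, F) := by
  let _ := UniformSpace.pseudoMetricSpace 𝓢(E, F)
  infer_instance

end Complete

/-! ### Symmetry of iterated derivatives -/

section SymmetryOfDerivatives

open LineDeriv FourierTransform

variable {E : Type*} [NormedAddCommGroup E] [InnerProductSpace ℝ E] [FiniteDimensional ℝ E]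
  [MeasurableSpace E] [BorelSpace E]

theorem SchwartzMap.fourier_iteratedLineDerivOp_apply (f : 𝓢(E, ℂ)) {n : ℕ} (v : Fin n → E)
    (ξ : E) : 𝓕 (∂^{v} f) ξ = (∏ j, 2 * Real.pi * Complex.I * (inner ℝ ξ (v j) : ℝ)) * 𝓕 f ξ := by
  induction n with
  | zero => simp
  | succ n ih =>
    rw [iteratedLineDerivOp_succ_left, SchwartzMap.fourier_lineDerivOp_eq, smul_apply,
      SchwartzMap.smulLeftCLM_apply_apply (by fun_prop), ih, Fin.prod_univ_succ]
    simp only [Fin.tail, smul_eq_mul, Complex.real_smul]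
    ring

/-- The Fourier transform turns the derivatives into a product of scalar factors, whose order is
irrelevant. -/
theorem SchwartzMap.iteratedLineDerivOp_comp_perm (f : 𝓢(E, ℂ)) {n : ℕ} (v : Fin n → E)
    (σ : Equiv.Perm (Fin n)) : ∂^{v ∘ σ} f = ∂^{v} f := by
  have h : 𝓕 (∂^{v ∘ σ} f) = 𝓕 (∂^{v} f) := by
    ext ξ
    rw [fourier_iteratedLineDerivOp_apply, fourier_iteratedLineDerivOp_apply]
    congr 1
    exact Equiv.prod_comp σ fun j => 2 * Real.pi * Complex.I * ((inner ℝ ξ (v j) : ℝ) : ℂ)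
  simpa using congrArg (𝓕⁻ ·) h

/-- The iterated derivative of a smooth function is symmetric. -/
theorem ContDiff.iteratedFDeriv_comp_perm {f : E → ℂ} (hf : ContDiff ℝ ∞ f) (x : E) {n : ℕ}
    (v : Fin n → E) (σ : Equiv.Perm (Fin n)) :
    iteratedFDeriv ℝ n f x (v ∘ σ) = iteratedFDeriv ℝ n f x v := by
  -- Multiplying by a bump function equal to `1` near `x` reduces to a Schwartz function without
  -- changing derivatives at `x`.
  let b : ContDiffBump x := ⟨1, 2, one_pos, one_lt_two⟩
  have hs : ContDiff ℝ ∞ fun y => ((b y : ℝ) : ℂ) * f y :=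
    (Complex.ofRealCLM.contDiff.comp b.contDiff).mul hf
  have hc : HasCompactSupport fun y => ((b y : ℝ) : ℂ) * f y :=
    (b.hasCompactSupport.comp_left Complex.ofReal_zero).mul_right
  have heq : f =ᶠ[nhds x] hc.toSchwartzMap hs := by
    filter_upwards [b.eventuallyEq_one] with y hy
    simp [hy]
  rw [(heq.iteratedFDeriv ℝ n).eq_of_nhds]
  rw [← SchwartzMap.iteratedLineDerivOp_eq_iteratedFDeriv,
    ← SchwartzMap.iteratedLineDerivOp_eq_iteratedFDeriv, SchwartzMap.iteratedLineDerivOp_comp_perm]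

end SymmetryOfDerivatives

/-! ### From multi-index bounds to norms of iterated derivatives -/

section GelfandShilovEstimates

/-- The multi-index that counts how often each coordinate occurs in `I`. -/
def multiCount {d n : ℕ} (I : Fin n → Fin d) (i : Fin d) : ℕ := Fintype.card {k // I k = i}

theorem sum_multiCount {d n : ℕ} (I : Fin n → Fin d) : ∑ i, multiCount I i = n := by
  unfold multiCount
  rw [← Fintype.card_sigma, Fintype.card_congr (Equiv.sigmaFiberEquiv I), Fintype.card_fin]

theorem prod_pow_multiCount {d n : ℕ} (I : Fin n → Fin d) (y : Fin d → ℝ) :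
    ∏ i, y i ^ multiCount I i = ∏ k, y (I k) := by
  rw [← Fintype.prod_fiberwise I]
  refine Finset.prod_congr rfl fun i _ => ?_
  rw [Fintype.prod_congr (fun k : {k // I k = i} => y (I k)) (fun _ => y i) fun k => by rw [k.2]]
  simp [multiCount]

/-- The two orders are kept as separate variables because the order `∑ i, multiCount I i` in
`multiDeriv` is equal to `n` only propositionally. -/
theorem iteratedFDeriv_comp_equiv {d N n : ℕ} {φ : Rn d → ℂ} (hφ : ContDiff ℝ ∞ φ) (x : Rn d)
    (e : Fin N ≃ Fin n) (v : Fin n → Rn d) :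
    iteratedFDeriv ℝ N φ x (fun k => v (e k)) = iteratedFDeriv ℝ n φ x v := by
  obtain rfl : N = n := by simpa using Fintype.card_congr e
  exact hφ.iteratedFDeriv_comp_perm x v e

theorem multiDeriv_multiCount {d n : ℕ} {φ : Rn d → ℂ} (hφ : ContDiff ℝ ∞ φ) (x : Rn d)
    (I : Fin n → Fin d) :
    multiDeriv (multiCount I) φ x =
      iteratedFDeriv ℝ n φ x (fun k => EuclideanSpace.single (I k) (1 : ℝ)) := by
  -- `multiDeriv` lists its directions sorted by coordinate. `e` sends a position in the sorted list
  -- to a coordinate and a rank in its fibre, and then to the original position in `I`.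
  let e : Fin (∑ i, multiCount I i) ≃ Fin n := finSigmaFinEquiv.symm.trans
    ((Equiv.sigmaCongrRight fun i => (Fintype.equivFin {k // I k = i}).symm).trans
      (Equiv.sigmaFiberEquiv I))
  rw [← iteratedFDeriv_comp_equiv hφ x e]
  unfold multiDeriv
  congr 1
  funext k
  congr 1
  exact ((Fintype.equivFin {k' // I k' = (finSigmaFinEquiv.symm k).1}).symm
    (finSigmaFinEquiv.symm k).2).2.symm

/-- Expand every argument in the standard basis. The `d^n` terms cost only a geometric factor in the
order `n`. -/
theorem ContinuousMultilinearMap.norm_le_sum_single {d n : ℕ}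
    (T : ContinuousMultilinearMap ℝ (fun _ : Fin n => Rn d) ℂ) :
    ‖T‖ ≤ ∑ I : Fin n → Fin d, ‖T fun k => EuclideanSpace.single (I k) (1 : ℝ)‖ := by
  refine T.opNorm_le_bound (Finset.sum_nonneg fun _ _ => norm_nonneg _) fun v => ?_
  have hv : v = fun k => ∑ i, v k i • EuclideanSpace.single i (1 : ℝ) := by
    funext k
    ext j
    simp [Pi.single_apply]
  have h1 : T v = ∑ I : Fin n → Fin d, (∏ k, v k (I k)) •
      T (fun k => EuclideanSpace.single (I k) (1 : ℝ)) := by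
    conv_lhs => rw [hv]
    rw [T.map_sum]
    exact Finset.sum_congr rfl fun I _ => T.map_smul_univ _ _
  rw [h1, Finset.sum_mul]
  refine (norm_sum_le _ _).trans (Finset.sum_le_sum fun I _ => ?_)
  rw [norm_smul, mul_comm, norm_prod]
  gcongr with k
  exact PiLp.norm_apply_le (v k) (I k)

theorem EuclideanSpace.norm_pow_le_sum_prod {d : ℕ} (a : ℕ) (x : Rn d) :
    ‖x‖ ^ a ≤ ∑ p : Fin a → Fin d, |∏ i, x i ^ multiCount p i| := by
  have h : ‖x‖ ≤ ∑ i, |x i| := by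
    have hx : x = ∑ i, x i • EuclideanSpace.single i (1 : ℝ) := by
      ext j
      simp [Pi.single_apply]
    conv_lhs => rw [hx]
    refine (norm_sum_le _ _).trans (Finset.sum_le_sum fun i _ => ?_)
    rw [norm_smul]
    simp
  refine (pow_le_pow_left₀ (norm_nonneg _) h a).trans (le_of_eq ?_)
  rw [Fintype.sum_pow]
  refine Finset.sum_congr rfl fun p _ => ?_
  rw [prod_pow_multiCount, Finset.abs_prod]

/-- It matters that `C` depends neither on `φ` nor on the order `n`. The exponent `max mu 0` covers
negative `mu`: the product of the `β i !` lies between `1` and `n!`, and passing to `n!` requires a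
nonnegative exponent. -/
theorem GSBound.exists_norm_iteratedFDeriv_le {d : ℕ} (lam mu : ℝ) {A : ℝ} (hA : 0 < A)
    (a : ℕ) : ∃ C : ℝ, 0 ≤ C ∧ ∀ (φ : Rn d → ℂ) (M : ℝ), ContDiff ℝ ∞ φ → GSBound lam mu A M φ →
      ∀ (n : ℕ) (x : Rn d), ‖x‖ ^ a * ‖iteratedFDeriv ℝ n φ x‖ ≤
        M * C * ((d * A) ^ n * (n.factorial : ℝ) ^ max mu 0) := by
  refine ⟨∑ p : Fin a → Fin d, A ^ a * ((∏ i, (multiCount p i).factorial : ℕ) : ℝ) ^ lam,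
    Finset.sum_nonneg fun _ _ => by positivity, fun φ M hφ h n x => ?_⟩
  have hM := h.nonneg
  calc ‖x‖ ^ a * ‖iteratedFDeriv ℝ n φ x‖
      ≤ (∑ p : Fin a → Fin d, |∏ i, x i ^ multiCount p i|) *
          ∑ I : Fin n → Fin d, ‖multiDeriv (multiCount I) φ x‖ := by
        gcongr
        · exact EuclideanSpace.norm_pow_le_sum_prod a x
        · simp only [multiDeriv_multiCount hφ]
          exact ContinuousMultilinearMap.norm_le_sum_single _
    _ = ∑ p : Fin a → Fin d, ∑ I : Fin n → Fin d,
          |∏ i, x i ^ multiCount p i| * ‖multiDeriv (multiCount I) φ x‖ := by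
        rw [Finset.sum_mul_sum]
    _ ≤ ∑ p : Fin a → Fin d, ∑ _I : Fin n → Fin d,
          M * A ^ (a + n) * ((∏ i, (multiCount p i).factorial : ℕ) : ℝ) ^ lam *
            (n.factorial : ℝ) ^ max mu 0 := by
        refine Finset.sum_le_sum fun p _ => Finset.sum_le_sum fun I _ => ?_
        refine (h (multiCount p) (multiCount I) x).trans ?_
        rw [sum_multiCount, sum_multiCount]
        have h1 : 1 ≤ ∏ i, (multiCount I i).factorial :=
          Nat.one_le_iff_ne_zero.2 (Finset.prod_ne_zero_iff.2 fun i _ => Nat.factorial_ne_zero _)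
        have h2 : ∏ i, (multiCount I i).factorial ≤ n.factorial := by
          have := Nat.le_of_dvd (Nat.factorial_pos _)
            (Nat.prod_factorial_dvd_factorial_sum Finset.univ (multiCount I))
          rwa [sum_multiCount] at this
        have h3 : ((∏ i, (multiCount I i).factorial : ℕ) : ℝ) ^ mu ≤
            (n.factorial : ℝ) ^ max mu 0 :=
          (Real.rpow_le_rpow_of_exponent_le (by exact_mod_cast h1) (le_max_left mu 0)).trans
            (Real.rpow_le_rpow (by positivity) (by exact_mod_cast h2) (le_max_right mu 0))
        gcongr
    _ = _ := by
        simp only [Finset.sum_const, Finset.card_univ, Fintype.card_fun, Fintype.card_fin,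
          nsmul_eq_mul, Finset.mul_sum, Finset.sum_mul]
        refine Finset.sum_congr rfl fun p _ => ?_
        push_cast
        rw [pow_add, mul_pow]
        ring

end GelfandShilovEstimates

/-! ### Derivatives of powers of the Laplacian -/

section Laplacian

open LineDeriv Laplacian

variable {d : ℕ}

theorem SchwartzMap.norm_iteratedFDeriv_lineDerivOp_le (v : Rn d) (f : 𝓢(Rn d, ℂ)) (l : ℕ)
    (x : Rn d) :
    ‖iteratedFDeriv ℝ l (∂_{v} f : 𝓢(Rn d, ℂ)) x‖ ≤ ‖v‖ * ‖iteratedFDeriv ℝ (l + 1) f x‖ := by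
  have h : (⇑(∂_{v} f : 𝓢(Rn d, ℂ)) : Rn d → ℂ) =
      (ContinuousLinearMap.apply ℝ ℂ v) ∘ (fderiv ℝ f) := rfl
  rw [h, ← norm_iteratedFDeriv_fderiv]
  have hf : ContDiffAt ℝ l (fderiv ℝ f) x :=
    ((f.smooth ⊤).fderiv_right (m := ∞) (by simp)).contDiffAt.of_le (mod_cast le_top)
  refine (ContinuousLinearMap.norm_iteratedFDeriv_comp_left _ hf le_rfl).trans ?_
  gcongr
  refine ContinuousLinearMap.opNorm_le_bound _ (norm_nonneg _) fun T => ?_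
  rw [mul_comm]
  exact T.le_opNorm v

theorem SchwartzMap.norm_iteratedFDeriv_laplacian_le (f : 𝓢(Rn d, ℂ)) (l : ℕ) (x : Rn d) :
    ‖iteratedFDeriv ℝ l (Δ f : 𝓢(Rn d, ℂ)) x‖ ≤ d * ‖iteratedFDeriv ℝ (l + 2) f x‖ := by
  rw [SchwartzMap.laplacian_eq_sum (EuclideanSpace.basisFun (Fin d) ℝ)]
  have h : (⇑(∑ i, ∂_{EuclideanSpace.basisFun (Fin d) ℝ i}
      (∂_{EuclideanSpace.basisFun (Fin d) ℝ i} f) : 𝓢(Rn d, ℂ)) : Rn d → ℂ) =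
      fun y => ∑ i, (∂_{EuclideanSpace.basisFun (Fin d) ℝ i}
        (∂_{EuclideanSpace.basisFun (Fin d) ℝ i} f) : 𝓢(Rn d, ℂ)) y := by
    funext y; simp
  rw [h, iteratedFDeriv_fun_sum_apply fun i _ => (SchwartzMap.smooth _ _).contDiffAt]
  refine (norm_sum_le _ _).trans ?_
  refine (Finset.sum_le_card_nsmul _ _ (‖iteratedFDeriv ℝ (l + 2) f x‖) fun i _ => ?_).trans
    (by simp)
  refine (norm_iteratedFDeriv_lineDerivOp_le _ _ l x).trans ?_
  refine (mul_le_mul_of_nonneg_left (norm_iteratedFDeriv_lineDerivOp_le _ f (l + 1) x)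
    (norm_nonneg _)).trans ?_
  simp

theorem SchwartzMap.norm_iteratedFDeriv_iterate_laplacian_le (f : 𝓢(Rn d, ℂ)) (j l : ℕ)
    (x : Rn d) : ‖iteratedFDeriv ℝ l (Δ^[j] f : 𝓢(Rn d, ℂ)) x‖ ≤
      d ^ j * ‖iteratedFDeriv ℝ (l + 2 * j) f x‖ := by
  induction j generalizing l with
  | zero => simp
  | succ j ih =>
    rw [Function.iterate_succ_apply']
    refine (norm_iteratedFDeriv_laplacian_le _ l x).trans ?_
    refine (mul_le_mul_of_nonneg_left (ih (l + 2)) (by positivity)).trans (le_of_eq ?_)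
    rw [show l + 2 + 2 * j = l + 2 * (j + 1) by ring]
    ring

end Laplacian

/-! ### The inverse heat operator on Gelfand–Shilov spaces -/

/-- `B^j ((l + 2j)!)^ν / j!` is summable for `ν < 1/2`. -/
theorem summable_pow_mul_factorial_rpow_div {B ν : ℝ} (hB : 0 ≤ B) (hν0 : 0 ≤ ν) (hν : ν < 1 / 2)
    (l : ℕ) : Summable fun j : ℕ => B ^ j * ((l + 2 * j).factorial : ℝ) ^ ν / j.factorial := by
  rcases hB.eq_or_lt with rfl | hB
  -- For `B = 0` the ratios are not under control, but only the term `j = 0` survives.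
  · refine summable_of_hasFiniteSupport ((Set.finite_singleton 0).subset fun j hj => ?_)
    by_contra h
    exact hj (by simp [zero_pow h])
  refine summable_of_ratio_test_tendsto_lt_one zero_lt_one
    (Filter.Eventually.of_forall fun j => by positivity) ?_
  -- Since both `l + 2j + 1` and `l + 2j + 2` are at most `(l + 2)(j + 1)`, the ratio of consecutive
  -- terms is at most `B (l+2)^(2ν) (j+1)^(2ν-1)`, which tends to `0` because `ν < 1/2`.
  have hlim : Filter.Tendsto (fun j : ℕ => B * (l + 2) ^ (2 * ν) *
      ((j : ℝ) + 1) ^ (-(1 - 2 * ν))) Filter.atTop (nhds 0) := by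
    rw [← mul_zero (B * (l + 2) ^ (2 * ν))]
    refine Filter.Tendsto.const_mul _ ?_
    refine (tendsto_rpow_neg_atTop (by linarith)).comp ?_
    exact Filter.tendsto_atTop_add_const_right _ _ tendsto_natCast_atTop_atTop
  refine squeeze_zero (fun j => by positivity) (fun j => ?_) hlim
  rw [Real.norm_of_nonneg (by positivity), Real.norm_of_nonneg (by positivity)]
  have h1 : ((l + 2 * (j + 1)).factorial : ℝ) =
      ((l + 2 * j + 2 : ℝ) * (l + 2 * j + 1)) * (l + 2 * j).factorial := by
    rw [show l + 2 * (j + 1) = (l + 2 * j + 1) + 1 by ring, Nat.factorial_succ,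
      Nat.factorial_succ]
    push_cast; ring
  have h2 : (((l + 2 * j + 2 : ℝ) * (l + 2 * j + 1))) ^ ν ≤
      (l + 2) ^ (2 * ν) * ((j : ℝ) + 1) ^ (2 * ν) := by
    rw [← Real.mul_rpow (by positivity) (by positivity), Real.rpow_mul (by positivity)]
    refine Real.rpow_le_rpow (by positivity) ?_ hν0
    rw [Real.rpow_two, sq]
    have hl : (0 : ℝ) ≤ l := by positivity
    have hj : (0 : ℝ) ≤ j := by positivity
    gcongr <;> nlinarith [mul_nonneg hl hj]
  have h3 : ((j : ℝ) + 1) ^ (-(1 - 2 * ν)) = ((j : ℝ) + 1) ^ (2 * ν) / (j + 1) := by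
    rw [show -(1 - 2 * ν) = 2 * ν - 1 by ring, Real.rpow_sub (by positivity), Real.rpow_one]
  rw [h1, Real.mul_rpow (by positivity) (by positivity), h3, Nat.factorial_succ, pow_succ]
  push_cast
  have h4 : (0 : ℝ) < ((l + 2 * j).factorial : ℝ) ^ ν := by positivity
  have h5 : (0 : ℝ) < (j.factorial : ℝ) := by positivity
  calc _ = B * ((l + 2 * j + 2 : ℝ) * (l + 2 * j + 1)) ^ ν / (j + 1) := by
        field_simp
    _ ≤ B * ((l + 2) ^ (2 * ν) * ((j : ℝ) + 1) ^ (2 * ν)) / (j + 1) := by gcongr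
    _ = _ := by ring

noncomputable section InverseHeat

open Laplacian FourierTransform

/-- The inclusion of `S(lam, mu)(ℝ^d)` in the Schwartz space. -/
def gsToSchwartz (d : ℕ) (lam mu : ℝ) : GelfandShilov d lam mu →ₗ[ℂ] 𝓢(Rn d, ℂ) where
  toFun φ := ⟨φ.1, φ.2.1, fun k l => by
    obtain ⟨hφ, A, M, hA, h⟩ := φ.2
    obtain ⟨C, -, hC⟩ := GSBound.exists_norm_iteratedFDeriv_le lam mu hA k
    exact ⟨_, hC φ.1 M hφ h l⟩⟩
  map_add' _ _ := rfl
  map_smul' _ _ := rfl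

theorem gsToSchwartz_coe {d : ℕ} {lam mu : ℝ} (φ : GelfandShilov d lam mu) :
    ⇑(gsToSchwartz d lam mu φ) = φ.1 := rfl

/-- The term `(-t)^j Δ^j / j!` of the series of `e^{-tΔ}`. -/
def invHeatTerm (d : ℕ) (t : ℝ) (j : ℕ) : 𝓢(Rn d, ℂ) →L[ℂ] 𝓢(Rn d, ℂ) :=
  (((-t) ^ j / j.factorial : ℝ) : ℂ) • LineDeriv.laplacianCLM ℂ (Rn d) 𝓢(Rn d, ℂ) ^ j

theorem invHeatTerm_apply {d : ℕ} (t : ℝ) (j : ℕ) (f : 𝓢(Rn d, ℂ)) :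
    invHeatTerm d t j f = (((-t) ^ j / j.factorial : ℝ) : ℂ) • Δ^[j] f := by
  have h : (⇑(LineDeriv.laplacianCLM ℂ (Rn d) 𝓢(Rn d, ℂ)) : 𝓢(Rn d, ℂ) → 𝓢(Rn d, ℂ)) = Δ :=
    funext fun g => SchwartzMap.laplacianCLM_eq ℂ g
  rw [invHeatTerm, smul_apply, FunLike.coe_pow_eq_iterate, h]

theorem SchwartzMap.fourier_iterate_laplacian_apply {d : ℕ} (f : 𝓢(Rn d, ℂ)) (j : ℕ) (ξ : Rn d) :
    𝓕 (Δ^[j] f) ξ = (-(4 * Real.pi ^ 2 * ‖ξ‖ ^ 2 : ℝ) : ℂ) ^ j * 𝓕 f ξ := by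
  induction j with
  | zero => simp
  | succ j ih =>
    rw [Function.iterate_succ_apply', SchwartzMap.laplacian_eq_fourierMultiplierCLM,
      FourierTransform.fourier_smul, SchwartzMap.fourierMultiplierCLM_apply,
      FourierTransform.fourier_fourierInv_eq, smul_apply,
      SchwartzMap.smulLeftCLM_apply_apply (by fun_prop), ih]
    simp only [Complex.real_smul]
    push_cast
    ring

theorem hasSum_fourier_invHeatTerm {d : ℕ} (t : ℝ) (f : 𝓢(Rn d, ℂ)) (ξ : Rn d) :
    HasSum (fun j => 𝓕 (invHeatTerm d t j f) ξ)
      (Complex.exp ((4 * Real.pi ^ 2 * t * ‖ξ‖ ^ 2 : ℝ)) * 𝓕 f ξ) := by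
  have h := (NormedSpace.expSeries_div_hasSum_exp
    ((4 * Real.pi ^ 2 * t * ‖ξ‖ ^ 2 : ℝ) : ℂ)).mul_right (𝓕 f ξ)
  rw [← Complex.exp_eq_exp_ℂ] at h
  refine h.congr_fun fun j => ?_
  rw [invHeatTerm_apply, FourierTransform.fourier_smul, smul_apply,
    SchwartzMap.fourier_iterate_laplacian_apply, smul_eq_mul, ← mul_assoc]
  congr 1
  push_cast
  rw [div_mul_eq_mul_div, ← mul_pow]
  congr 2
  ring

/-- Evaluation of a Schwartz function at a point. -/
def SchwartzMap.pointEvalCLM {d : ℕ} (x : Rn d) : 𝓢(Rn d, ℂ) →L[ℂ] ℂ :=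
  (BoundedContinuousFunction.evalCLM ℂ x).comp
    (SchwartzMap.toBoundedContinuousFunctionCLM ℂ (Rn d) ℂ)

@[simp]
theorem SchwartzMap.pointEvalCLM_apply {d : ℕ} (x : Rn d) (f : 𝓢(Rn d, ℂ)) :
    SchwartzMap.pointEvalCLM x f = f x := rfl

/-- Schwartz convergence implies pointwise convergence of the Fourier transforms, so `𝓕 g` is `𝓕 f`
times an exponential that the heat multiplier cancels. -/
theorem heat_eq_of_hasSum_invHeatTerm {d : ℕ} {t : ℝ} (ht : 0 ≤ t) {f g : 𝓢(Rn d, ℂ)}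
    (h : HasSum (fun j => invHeatTerm d t j f) g) : heat d t g = f := by
  have h1 : ∀ ξ, 𝓕 g ξ = Complex.exp ((4 * Real.pi ^ 2 * t * ‖ξ‖ ^ 2 : ℝ)) * 𝓕 f ξ := fun ξ =>
    (((SchwartzMap.pointEvalCLM ξ).comp (fourierCLM ℂ 𝓢(Rn d, ℂ))).hasSum h).unique
      (hasSum_fourier_invHeatTerm t f ξ)
  have h2 : 𝓕 (heat d t g) = 𝓕 f := by
    ext ξ
    rw [heat, SchwartzMap.fourierMultiplierCLM_apply, FourierTransform.fourier_fourierInv_eq,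
      SchwartzMap.smulLeftCLM_apply_apply (heatMultiplier_hasTemperateGrowth d ht), h1,
      heatMultiplier, smul_eq_mul, ← mul_assoc, Complex.ofReal_exp, ← Complex.exp_add]
    simp
  simpa using congrArg (𝓕⁻ ·) h2

/-- The majorant `b` is the same for all `φ` in `S_A`, and `φ` enters only through the factor `M`.
This yields both convergence of the series and continuity of its sum. -/
theorem exists_seminorm_invHeatTerm_le (d : ℕ) (lam : ℝ) {mu A t : ℝ} (hmu : mu < 1 / 2)
    (hA : 0 < A) (ht : 0 ≤ t) (k l : ℕ) :
    ∃ b : ℕ → ℝ, Summable b ∧ ∀ (φ : GelfandShilov d lam mu) (M : ℝ), GSBound lam mu A M φ.1 →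
      ∀ j, SchwartzMap.seminorm ℝ k l (invHeatTerm d t j (gsToSchwartz d lam mu φ)) ≤
        b j * M := by
  obtain ⟨C, hC0, hC⟩ := GSBound.exists_norm_iteratedFDeriv_le (d := d) lam mu hA k
  refine ⟨fun j => (C * (d * A) ^ l) * ((t * d * (d * A) ^ 2) ^ j *
    ((l + 2 * j).factorial : ℝ) ^ max mu 0 / j.factorial),
    (summable_pow_mul_factorial_rpow_div (by positivity) (le_max_right _ _)
      (max_lt hmu (by norm_num)) l).mul_left _, fun φ M h j => ?_⟩
  have hM := h.nonneg
  refine SchwartzMap.seminorm_le_bound ℝ k l _ (by positivity) fun x => ?_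
  rw [invHeatTerm_apply]
  have h1 : iteratedFDeriv ℝ l (⇑((((-t) ^ j / j.factorial : ℝ) : ℂ) •
      Δ^[j] (gsToSchwartz d lam mu φ))) x = (((-t) ^ j / j.factorial : ℝ) : ℂ) •
        iteratedFDeriv ℝ l (Δ^[j] (gsToSchwartz d lam mu φ) : 𝓢(Rn d, ℂ)) x :=
    iteratedFDeriv_const_smul_apply (SchwartzMap.smooth _ _).contDiffAt
  have h2 := hC φ.1 M φ.2.1 h (l + 2 * j) x
  have h3 := SchwartzMap.norm_iteratedFDeriv_iterate_laplacian_le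
    (gsToSchwartz d lam mu φ) j l x
  have h4 : ‖(((-t) ^ j / j.factorial : ℝ) : ℂ)‖ = t ^ j / j.factorial := by
    rw [Complex.norm_real, norm_div, norm_pow, norm_neg, Real.norm_of_nonneg ht,
      Real.norm_of_nonneg (by positivity)]
  rw [h1, norm_smul, h4]
  calc _ ≤ ‖x‖ ^ k * (t ^ j / j.factorial *
        (d ^ j * ‖iteratedFDeriv ℝ (l + 2 * j) (gsToSchwartz d lam mu φ) x‖)) := by gcongr
    _ = (t ^ j / j.factorial * d ^ j) *
        (‖x‖ ^ k * ‖iteratedFDeriv ℝ (l + 2 * j) φ.1 x‖) := by rw [gsToSchwartz_coe]; ring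
    _ ≤ (t ^ j / j.factorial * d ^ j) *
        (M * C * ((d * A) ^ (l + 2 * j) * ((l + 2 * j).factorial : ℝ) ^ max mu 0)) := by gcongr
    _ = _ := by
        rw [pow_add, pow_mul, mul_pow, mul_pow]
        ring

theorem summable_invHeatTerm {d : ℕ} {lam mu t : ℝ} (hmu : mu < 1 / 2) (ht : 0 ≤ t)
    (φ : GelfandShilov d lam mu) :
    Summable fun j => invHeatTerm d t j (gsToSchwartz d lam mu φ) := by
  obtain ⟨-, A, M, hA, h⟩ := φ.2
  refine SchwartzMap.summable_of_summable_seminorm fun k l => ?_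
  obtain ⟨b, hb, hbd⟩ := exists_seminorm_invHeatTerm_le d lam hmu hA ht k l
  exact (hb.mul_right M).of_nonneg_of_le (fun _ => apply_nonneg _ _) (hbd φ M h)

/-- The operator `e^{-tΔ}` from `S(lam, mu)(ℝ^d)` to the Schwartz space, as a linear map. -/
def invHeatLM (d : ℕ) (lam : ℝ) {mu t : ℝ} (hmu : mu < 1 / 2) (ht : 0 ≤ t) :
    GelfandShilov d lam mu →ₗ[ℂ] 𝓢(Rn d, ℂ) where
  toFun φ := ∑' j, invHeatTerm d t j (gsToSchwartz d lam mu φ)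
  map_add' φ ψ := by
    simp only [map_add]
    exact (summable_invHeatTerm hmu ht φ).tsum_add (summable_invHeatTerm hmu ht ψ)
  map_smul' c φ := by
    simp only [map_smul, RingHom.id_apply]
    exact (summable_invHeatTerm hmu ht φ).tsum_const_smul c

theorem continuous_invHeatLM (d : ℕ) (lam : ℝ) {mu t : ℝ} (hmu : mu < 1 / 2) (ht : 0 ≤ t) :
    Continuous (invHeatLM d lam hmu ht) := by
  refine WithSeminorms.continuous_of_isBounded (gelfandShilov_withSeminorms d lam mu)
    (schwartz_withSeminorms ℂ (Rn d) ℂ) _ ?_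
  rintro ⟨k, l⟩
  have hp : ∀ A : ℝ, 0 < A → ∃ C : ℝ, ∀ (φ : GelfandShilov d lam mu) (M : ℝ),
      GSBound lam mu A M φ.1 →
        (SchwartzMap.seminorm ℂ k l).comp (invHeatLM d lam hmu ht) φ ≤ C * M := by
    intro A hA
    obtain ⟨b, hb, hbd⟩ := exists_seminorm_invHeatTerm_le d lam hmu hA ht k l
    refine ⟨∑' j, b j, fun φ M h => ?_⟩
    have hs : Summable fun j =>
        SchwartzMap.seminorm ℝ k l (invHeatTerm d t j (gsToSchwartz d lam mu φ)) :=
      (hb.mul_right M).of_nonneg_of_le (fun _ => apply_nonneg _ _) (hbd φ M h)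
    refine (Seminorm.le_tsum_of_hasSum
      ((schwartz_withSeminorms ℝ (Rn d) ℂ).continuous_seminorm (k, l))
      (summable_invHeatTerm hmu ht φ).hasSum hs).trans ?_
    rw [← tsum_mul_right]
    exact hs.tsum_le_tsum (hbd φ M h) (hb.mul_right M)
  -- The pulled-back Schwartz seminorm is itself one of the seminorms that define the inductive
  -- limit topology, so it is bounded by itself.
  let P : GSSeminorm d lam mu := ⟨_, hp⟩
  refine ⟨{P}, 1, ?_⟩
  rw [one_smul]
  exact Finset.le_sup (f := gsSeminormFamily d lam mu) (Finset.mem_singleton_self P)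

/-- The operator `e^{-tΔ}` from `S(lam, mu)(ℝ^d)` to the Schwartz space. -/
def invHeat (d : ℕ) (lam : ℝ) {mu t : ℝ} (hmu : mu < 1 / 2) (ht : 0 ≤ t) :
    GelfandShilov d lam mu →L[ℂ] 𝓢(Rn d, ℂ) :=
  ⟨invHeatLM d lam hmu ht, continuous_invHeatLM d lam hmu ht⟩

theorem heat_invHeat {d : ℕ} {lam mu t : ℝ} (hmu : mu < 1 / 2) (ht : 0 ≤ t)
    (φ : GelfandShilov d lam mu) :
    heat d t (invHeat d lam hmu ht φ) = gsToSchwartz d lam mu φ :=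
  heat_eq_of_hasSum_invHeatTerm ht (summable_invHeatTerm hmu ht φ).hasSum

theorem gelfandShilov_le_heatImage (d : ℕ) (lam : ℝ) {mu t : ℝ} (hmu : mu < 1 / 2)
    (ht : 0 ≤ t) : gelfandShilov d lam mu ≤ heatImage d t := fun φ hφ =>
  ⟨invHeat d lam hmu ht ⟨φ, hφ⟩, congrArg DFunLike.coe (heat_invHeat hmu ht ⟨φ, hφ⟩)⟩

theorem toHeatSpace_invHeat {d : ℕ} {lam mu t : ℝ} (hmu : mu < 1 / 2) (ht : 0 ≤ t)
    (h : gelfandShilov d lam mu ≤ heatImage d t) (φ : GelfandShilov d lam mu) :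
    toHeatSpace d t (invHeat d lam hmu ht φ) = gsInclusion h φ :=
  Subtype.ext (congrArg DFunLike.coe (heat_invHeat hmu ht φ))

theorem continuous_gsInclusion {d : ℕ} {lam mu t : ℝ} (hmu : mu < 1 / 2) (ht : 0 ≤ t)
    (h : gelfandShilov d lam mu ≤ heatImage d t) : Continuous (gsInclusion h) := by
  have : ⇑(gsInclusion h) = toHeatSpace d t ∘ invHeat d lam hmu ht :=
    funext fun φ => (toHeatSpace_invHeat hmu ht h φ).symm
  rw [this]
  exact continuous_coinduced_rng.comp (invHeat d lam hmu ht).continuous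

end InverseHeat

/-! ### Increasing Schwartz norms and their behaviour under translation -/

noncomputable section SchwartzNorm

variable {E F G H : Type*} [NormedAddCommGroup E] [NormedSpace ℝ E] [NormedAddCommGroup F]
  [NormedSpace ℝ F] [NormedAddCommGroup G] [NormedSpace ℝ G] [NormedAddCommGroup H]
  [NormedSpace ℝ H]

/-- The increasing sequence of norms `max_{k, l ≤ N} sup_x ‖x‖^k ‖D^l f(x)‖`. -/
def schwartzNorm (N : ℕ) : Seminorm ℝ 𝓢(E, F) :=
  (Finset.Iic (N, N)).sup (schwartzSeminormFamily ℝ E F)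

theorem schwartzNorm_nonneg (N : ℕ) (f : 𝓢(E, F)) : 0 ≤ schwartzNorm N f := apply_nonneg _ _

theorem seminorm_le_schwartzNorm {k l N : ℕ} (hk : k ≤ N) (hl : l ≤ N) (f : 𝓢(E, F)) :
    SchwartzMap.seminorm ℝ k l f ≤ schwartzNorm N f :=
  Seminorm.le_def.1 (Finset.le_sup (f := schwartzSeminormFamily ℝ E F)
    (Finset.mem_Iic.2 (Prod.mk_le_mk.2 ⟨hk, hl⟩))) f

theorem schwartzNorm_le {N : ℕ} {f : 𝓢(E, F)} {C : ℝ} (hC : 0 ≤ C)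
    (h : ∀ k ≤ N, ∀ l ≤ N, ∀ x, ‖x‖ ^ k * ‖iteratedFDeriv ℝ l f x‖ ≤ C) :
    schwartzNorm N f ≤ C := by
  refine Seminorm.finset_sup_apply_le hC fun i hi => ?_
  obtain ⟨hk, hl⟩ := Prod.mk_le_mk.1 (Finset.mem_Iic.1 hi)
  exact SchwartzMap.seminorm_le_bound ℝ _ _ f hC (h i.1 hk i.2 hl)

theorem one_add_pow_mul_le_schwartzNorm {k l N : ℕ} (hk : k ≤ N) (hl : l ≤ N) (f : 𝓢(E, F))
    (x : E) : (1 + ‖x‖) ^ k * ‖iteratedFDeriv ℝ l f x‖ ≤ 2 ^ N * schwartzNorm N f :=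
  SchwartzMap.one_add_le_sup_seminorm_apply (𝕜 := ℝ) (m := (N, N)) hk hl f x

theorem continuous_schwartzNorm (N : ℕ) :
    Continuous (schwartzNorm N : 𝓢(E, F) → ℝ) := by
  refine Seminorm.continuous (r := 1) ?_
  exact (schwartz_withSeminorms ℝ E F).hasBasis_zero_ball.mem_of_mem
    (i := (Finset.Iic (N, N), 1)) one_pos

theorem Seminorm.exists_le_schwartzNorm {p : Seminorm ℝ 𝓢(E, F)} (hp : Continuous p) :
    ∃ (C : ℝ) (N : ℕ), 0 ≤ C ∧ ∀ f, p f ≤ C * schwartzNorm N f := by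
  obtain ⟨s, C, -, h⟩ := Seminorm.bound_of_continuous (schwartz_withSeminorms ℝ E F) p hp
  refine ⟨C, s.sup fun i => max i.1 i.2, C.2, fun f => (h f).trans ?_⟩
  refine mul_le_mul_of_nonneg_left (Seminorm.finset_sup_apply_le (schwartzNorm_nonneg _ _)
    fun i hi => ?_) C.2
  have := Finset.le_sup (f := fun i : ℕ × ℕ => max i.1 i.2) hi
  exact seminorm_le_schwartzNorm ((le_max_left _ _).trans this) ((le_max_right _ _).trans this) f

theorem ContinuousLinearMap.exists_norm_le_schwartzNorm (u : 𝓢(E, F) →L[ℝ] G) :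
    ∃ (C : ℝ) (N : ℕ), 0 ≤ C ∧ ∀ f, ‖u f‖ ≤ C * schwartzNorm N f :=
  Seminorm.exists_le_schwartzNorm (p := (normSeminorm ℝ G).comp u.toLinearMap)
    (continuous_norm.comp u.continuous)

theorem ContinuousLinearMap.exists_schwartzNorm_le (T : 𝓢(E, F) →L[ℝ] 𝓢(G, H)) (N : ℕ) :
    ∃ (C : ℝ) (M : ℕ), 0 ≤ C ∧ ∀ f, schwartzNorm N (T f) ≤ C * schwartzNorm M f := by
  have hp : Continuous ((schwartzNorm N : Seminorm ℝ 𝓢(G, H)).comp T.toLinearMap) :=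
    (continuous_schwartzNorm N).comp T.continuous
  exact Seminorm.exists_le_schwartzNorm hp

theorem continuous_of_schwartzNorm_le (T : 𝓢(E, F) →ₗ[ℝ] 𝓢(G, H))
    (h : ∀ N, ∃ (C : ℝ) (M : ℕ), ∀ f, schwartzNorm N (T f) ≤ C * schwartzNorm M f) :
    Continuous T := by
  refine WithSeminorms.continuous_of_isBounded (schwartz_withSeminorms ℝ E F)
    (schwartz_withSeminorms ℝ G H) T ?_
  rintro ⟨k, l⟩
  obtain ⟨C, M, hC⟩ := h (max k l)
  refine ⟨Finset.Iic (M, M), C.toNNReal, fun f => ?_⟩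
  refine (seminorm_le_schwartzNorm (le_max_left k l) (le_max_right k l) _).trans
    ((hC f).trans ?_)
  exact mul_le_mul_of_nonneg_right (Real.le_coe_toNNReal C) (schwartzNorm_nonneg M f)

theorem summable_of_summable_schwartzNorm {ι : Type*} [CompleteSpace F] {g : ι → 𝓢(E, F)}
    (h : ∀ N, Summable fun i => schwartzNorm N (g i)) : Summable g :=
  SchwartzMap.summable_of_summable_seminorm fun k l =>
    (h (max k l)).of_nonneg_of_le (fun _ => apply_nonneg _ _)
      fun i => seminorm_le_schwartzNorm (le_max_left k l) (le_max_right k l) (g i)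

theorem schwartzNorm_compSubConstCLM_le (N : ℕ) (v : E) (f : 𝓢(E, F)) :
    schwartzNorm N (SchwartzMap.compSubConstCLM ℝ v f) ≤
      2 ^ N * (1 + ‖v‖) ^ N * schwartzNorm N f := by
  refine schwartzNorm_le (mul_nonneg (by positivity) (schwartzNorm_nonneg _ _))
    fun k hk l hl x => ?_
  have h1 : iteratedFDeriv ℝ l (SchwartzMap.compSubConstCLM ℝ v f) x =
      iteratedFDeriv ℝ l f (x - v) := by
    have : ⇑(SchwartzMap.compSubConstCLM ℝ v f) = fun y => f (y - v) :=
      funext fun y => SchwartzMap.compSubConstCLM_apply f v y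
    rw [this, iteratedFDeriv_comp_sub]
  rw [h1]
  have h2 : ‖x‖ ≤ (1 + ‖v‖) * (1 + ‖x - v‖) := by
    have := norm_add_le (x - v) v
    rw [sub_add_cancel] at this
    nlinarith [norm_nonneg v, norm_nonneg (x - v)]
  calc ‖x‖ ^ k * ‖iteratedFDeriv ℝ l f (x - v)‖
      ≤ ((1 + ‖v‖) * (1 + ‖x - v‖)) ^ k * ‖iteratedFDeriv ℝ l f (x - v)‖ := by gcongr
    _ = (1 + ‖v‖) ^ k * ((1 + ‖x - v‖) ^ k * ‖iteratedFDeriv ℝ l f (x - v)‖) := by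
        rw [mul_pow]; ring
    _ ≤ (1 + ‖v‖) ^ N * (2 ^ N * schwartzNorm N f) := by
        have h3 := one_add_pow_mul_le_schwartzNorm hk hl f (x - v)
        have h4 : (1 : ℝ) ≤ 1 + ‖v‖ := by linarith [norm_nonneg v]
        gcongr
    _ = _ := by ring

/-- A fixed Schwartz function times a translate of `f` decays rapidly in the translation. -/
theorem exists_schwartzNorm_mul_compSubConst_le (χ : 𝓢(E, ℂ)) (M N : ℕ) :
    ∃ C : ℝ, 0 ≤ C ∧ ∀ (v : E) (f : 𝓢(E, ℂ)), (1 + ‖v‖) ^ N *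
      schwartzNorm M (SchwartzMap.smulLeftCLM ℂ χ (SchwartzMap.compSubConstCLM ℂ (-v) f)) ≤
        C * schwartzNorm (M + N) f := by
  set K := 2 ^ (M + N) * schwartzNorm (M + N) χ with hK
  have hK0 : 0 ≤ K := mul_nonneg (by positivity) (schwartzNorm_nonneg _ _)
  refine ⟨2 ^ M * K * 2 ^ (M + N), by positivity, fun v f => ?_⟩
  have hf0 := schwartzNorm_nonneg (M + N) f
  rw [mul_comm, ← le_div_iff₀ (by positivity)]
  refine schwartzNorm_le (by positivity) fun k hk l hl x => ?_
  rw [le_div_iff₀ (by positivity)]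
  have h1 : ⇑(SchwartzMap.smulLeftCLM ℂ χ (SchwartzMap.compSubConstCLM ℂ (-v) f)) =
      fun y => χ y * f (y + v) := by
    funext y
    rw [SchwartzMap.smulLeftCLM_apply_apply χ.hasTemperateGrowth,
      SchwartzMap.compSubConstCLM_apply, sub_neg_eq_add, smul_eq_mul]
  have hfv : ContDiff ℝ ∞ fun y => f (y + v) := (f.smooth ⊤).comp (by fun_prop)
  have h2 := norm_iteratedFDeriv_mul_le (χ.smooth ⊤) hfv x (n := l) (mod_cast le_top)
  -- The growth in `v` is shared between `χ`, which decays in `x`, and `f`, which decays in `x + v`.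
  -- This uses up `N` further powers of decay of each.
  have h3 : 1 + ‖v‖ ≤ (1 + ‖x‖) * (1 + ‖x + v‖) := by
    have := norm_sub_le (x + v) x
    rw [add_sub_cancel_left] at this
    nlinarith [norm_nonneg x, norm_nonneg (x + v)]
  rw [h1]
  calc ‖x‖ ^ k * ‖iteratedFDeriv ℝ l (fun y => χ y * f (y + v)) x‖ * (1 + ‖v‖) ^ N
      ≤ (1 + ‖x‖) ^ k * (∑ i ∈ Finset.range (l + 1), (l.choose i : ℝ) *
          ‖iteratedFDeriv ℝ i χ x‖ * ‖iteratedFDeriv ℝ (l - i) f (x + v)‖) *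
            ((1 + ‖x‖) * (1 + ‖x + v‖)) ^ N := by
        gcongr
        · linarith
        · simpa only [iteratedFDeriv_comp_add_right] using h2
    _ = ∑ i ∈ Finset.range (l + 1), (l.choose i : ℝ) *
          ((1 + ‖x‖) ^ (k + N) * ‖iteratedFDeriv ℝ i χ x‖) *
            ((1 + ‖x + v‖) ^ N * ‖iteratedFDeriv ℝ (l - i) f (x + v)‖) := by
        rw [Finset.mul_sum, Finset.sum_mul]
        refine Finset.sum_congr rfl fun i _ => ?_
        rw [mul_pow, pow_add]
        ring
    _ ≤ ∑ i ∈ Finset.range (l + 1), (l.choose i : ℝ) * K *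
          (2 ^ (M + N) * schwartzNorm (M + N) f) := by
        refine Finset.sum_le_sum fun i hi => ?_
        have hi' : i ≤ l := Finset.mem_range_succ_iff.1 hi
        have h4 := one_add_pow_mul_le_schwartzNorm (k := k + N) (l := i) (N := M + N) (by omega)
          (by omega) χ x
        have h5 := one_add_pow_mul_le_schwartzNorm (k := N) (l := l - i) (N := M + N) (by omega)
          (by omega) f (x + v)
        gcongr
    _ = 2 ^ l * K * 2 ^ (M + N) * schwartzNorm (M + N) f := by
        rw [← Finset.sum_mul, ← Finset.sum_mul]
        have : (∑ i ∈ Finset.range (l + 1), (l.choose i : ℝ)) = 2 ^ l := by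
          exact_mod_cast Nat.sum_range_choose l
        rw [this]
        ring
    _ ≤ 2 ^ M * K * 2 ^ (M + N) * schwartzNorm (M + N) f := by
        gcongr
        norm_num

end SchwartzNorm

/-! ### Cutoff functions and a partition of unity -/

noncomputable section Cutoff

open FourierTransform

/-- A smooth function of one variable supported in `[a/4, (b+1)/4]`. -/
def cutoff (a b x : ℝ) : ℝ := Real.smoothTransition (4 * x - a) - Real.smoothTransition (4 * x - b)

theorem contDiff_cutoff (a b : ℝ) : ContDiff ℝ ∞ (cutoff a b) := by
  unfold cutoff
  exact (Real.smoothTransition.contDiff.comp (by fun_prop)).sub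
    (Real.smoothTransition.contDiff.comp (by fun_prop))

theorem cutoff_eq_zero_of_le {a b x : ℝ} (hab : a ≤ b) (h : 4 * x ≤ a) : cutoff a b x = 0 := by
  rw [cutoff, Real.smoothTransition.zero_of_nonpos (by linarith),
    Real.smoothTransition.zero_of_nonpos (by linarith), sub_zero]

theorem cutoff_eq_zero_of_ge {a b x : ℝ} (hab : a ≤ b) (h : b + 1 ≤ 4 * x) :
    cutoff a b x = 0 := by
  rw [cutoff, Real.smoothTransition.one_of_one_le (by linarith),
    Real.smoothTransition.one_of_one_le (by linarith), sub_self]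

theorem cutoff_eq_one {a b x : ℝ} (ha : a + 1 ≤ 4 * x) (hb : 4 * x ≤ b) : cutoff a b x = 1 := by
  rw [cutoff, Real.smoothTransition.one_of_one_le (by linarith),
    Real.smoothTransition.zero_of_nonpos (by linarith), sub_zero]

theorem contDiff_prod_cutoff (d : ℕ) (a b : ℝ) :
    ContDiff ℝ ∞ fun x : Rn d => ((∏ i, cutoff a b (x i) : ℝ) : ℂ) := by
  have h : ContDiff ℝ ∞ fun x : Rn d => ∏ i, cutoff a b (x i) :=
    contDiff_prod fun i _ => (contDiff_cutoff a b).comp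
      (by fun_prop : ContDiff ℝ ∞ fun x : Rn d => x i)
  exact Complex.ofRealCLM.contDiff.comp h

theorem hasCompactSupport_prod_cutoff (d : ℕ) {a b : ℝ} (hab : a ≤ b) :
    HasCompactSupport fun x : Rn d => ((∏ i, cutoff a b (x i) : ℝ) : ℂ) := by
  have hK : IsCompact ((fun x : Rn d => x.ofLp) ⁻¹'
      Set.univ.pi fun _ : Fin d => Set.Icc (a / 4) ((b + 1) / 4)) :=
    (PiLp.homeomorph 2 fun _ : Fin d => ℝ).isCompact_preimage.2
      (isCompact_univ_pi fun _ => isCompact_Icc)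
  refine HasCompactSupport.intro hK fun x hx => ?_
  simp only [Set.mem_preimage, Set.mem_univ_pi, Set.mem_Icc, not_forall, not_and_or,
    not_le] at hx
  obtain ⟨i, hi⟩ := hx
  rw [Finset.prod_eq_zero (Finset.mem_univ i), Complex.ofReal_zero]
  rcases hi with hi | hi
  · exact cutoff_eq_zero_of_le hab (by linarith)
  · exact cutoff_eq_zero_of_ge hab (by linarith)

/-- The Schwartz function `x ↦ ∏ i, cutoff a b (x i)`. -/
def prodCutoff (d : ℕ) {a b : ℝ} (hab : a ≤ b) : 𝓢(Rn d, ℂ) :=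
  (hasCompactSupport_prod_cutoff d hab).toSchwartzMap (contDiff_prod_cutoff d a b)

/-- A bump function on the cube `[0, 1/2]^d` whose translates by `ℤ^d/4` add up to `1`. -/
def innerBump (d : ℕ) : 𝓢(Rn d, ℂ) := prodCutoff d (zero_le_one' ℝ)

/-- A bump function on the cube `[-1/4, 3/4]^d` that equals `1` on `[0, 1/2]^d`. -/
def outerBump (d : ℕ) : 𝓢(Rn d, ℂ) := prodCutoff d (show (-1 : ℝ) ≤ 2 by norm_num)

theorem innerBump_apply {d : ℕ} (x : Rn d) :
    innerBump d x = ((∏ i, cutoff 0 1 (x i) : ℝ) : ℂ) := rfl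

theorem outerBump_apply {d : ℕ} (x : Rn d) :
    outerBump d x = ((∏ i, cutoff (-1) 2 (x i) : ℝ) : ℂ) := rfl

/-- The point `k` of the lattice `ℤ^d`. -/
def latticePoint {d : ℕ} (k : Fin d → ℤ) : Rn d := WithLp.toLp 2 fun i => (k i : ℝ)

@[simp]
theorem latticePoint_apply {d : ℕ} (k : Fin d → ℤ) (i : Fin d) : latticePoint k i = k i := rfl

/-- `cutoff 0 1 (y - j/4)` is the difference of the smooth step at `4y - j` and at `4y - j - 1`.
Only `j = ⌊4y⌋ - 1` and `j = ⌊4y⌋` contribute, and their sum telescopes to `1 - 0`. -/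
theorem exists_finset_sum_cutoff (y : ℝ) : ∃ s : Finset ℤ,
    (∀ j ∉ s, cutoff 0 1 (y - j / 4) = 0) ∧ ∑ j ∈ s, cutoff 0 1 (y - j / 4) = 1 := by
  have h1 := Int.floor_le (4 * y)
  have h2 := Int.lt_floor_add_one (4 * y)
  refine ⟨{⌊4 * y⌋ - 1, ⌊4 * y⌋}, fun j hj => ?_, ?_⟩
  · simp only [Finset.mem_insert, Finset.mem_singleton, not_or] at hj
    rcases lt_or_gt_of_ne hj.2 with h | h
    · have h3 : j + 2 ≤ ⌊4 * y⌋ := by omega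
      have h4 : (j : ℝ) + 2 ≤ ⌊4 * y⌋ := by exact_mod_cast h3
      exact cutoff_eq_zero_of_ge zero_le_one (by linarith)
    · have h4 : (⌊4 * y⌋ : ℝ) + 1 ≤ j := by exact_mod_cast h
      exact cutoff_eq_zero_of_le zero_le_one (by linarith)
  · rw [Finset.sum_pair (by omega)]
    unfold cutoff
    push_cast
    rw [show 4 * (y - ((⌊4 * y⌋ : ℝ) - 1) / 4) - 1 = 4 * (y - (⌊4 * y⌋ : ℝ) / 4) - 0 by ring,
      sub_add_sub_cancel, Real.smoothTransition.one_of_one_le (by linarith),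
      Real.smoothTransition.zero_of_nonpos (by linarith), sub_zero]

/-- The translates of `innerBump d` by `ℤ^d/4` form a partition of unity. -/
theorem hasSum_innerBump {d : ℕ} (x : Rn d) :
    HasSum (fun k : Fin d → ℤ => innerBump d (x - (1 / 4 : ℝ) • latticePoint k)) 1 := by
  choose s hs0 hs1 using fun i => exists_finset_sum_cutoff (x i)
  have happ : ∀ k : Fin d → ℤ, innerBump d (x - (1 / 4 : ℝ) • latticePoint k) =
      ((∏ i, cutoff 0 1 (x i - k i / 4) : ℝ) : ℂ) := by
    intro k
    rw [innerBump_apply]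
    congr 2
    funext i
    simp [div_eq_inv_mul]
  simp only [happ]
  have hsum : ∑ k ∈ Fintype.piFinset s, ((∏ i, cutoff 0 1 (x i - k i / 4) : ℝ) : ℂ) = 1 := by
    rw [← Complex.ofReal_sum,
      ← Finset.prod_univ_sum s (fun i j => cutoff 0 1 (x i - (j : ℝ) / 4))]
    simp [hs1]
  rw [← hsum]
  refine hasSum_sum_of_ne_finset_zero fun k hk => ?_
  simp only [Fintype.mem_piFinset, not_forall] at hk
  obtain ⟨i, hi⟩ := hk
  rw [Finset.prod_eq_zero (Finset.mem_univ i) (hs0 i _ hi), Complex.ofReal_zero]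

end Cutoff

/-! ### Summability over lattices -/

noncomputable section LatticeSums

theorem summable_prod_apply {d : ℕ} {κ : Type*} [DecidableEq κ] {g : κ → ℝ} (hg0 : ∀ j, 0 ≤ g j)
    (hg : Summable g) : Summable fun k : Fin d → κ => ∏ i, g (k i) := by
  refine summable_of_sum_le (c := ∏ _i : Fin d, ∑' j, g j)
    (fun k => Finset.prod_nonneg fun i _ => hg0 _) fun u => ?_
  let s : Fin d → Finset κ := fun i => u.image fun k => k i
  calc ∑ k ∈ u, ∏ i, g (k i) ≤ ∑ k ∈ Fintype.piFinset s, ∏ i, g (k i) := by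
        refine Finset.sum_le_sum_of_subset_of_nonneg (fun k hk => ?_)
          fun k _ _ => Finset.prod_nonneg fun i _ => hg0 _
        exact Fintype.mem_piFinset.2 fun i => Finset.mem_image_of_mem _ hk
    _ = ∏ i, ∑ j ∈ s i, g j := (Finset.prod_univ_sum s fun _ j => g j).symm
    _ ≤ _ := Finset.prod_le_prod (fun i _ => Finset.sum_nonneg fun j _ => hg0 j)
        fun i _ => hg.sum_le_tsum _ fun j _ => hg0 j

theorem summable_one_add_abs_int_sq : Summable fun j : ℤ => ((1 + |(j : ℝ)|) ^ 2)⁻¹ := by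
  have h : Summable fun n : ℕ => ((1 + |(n : ℝ)|) ^ 2)⁻¹ := by
    have := (summable_nat_add_iff 1).2 (Real.summable_nat_pow_inv.2 (one_lt_two))
    refine this.congr fun n => ?_
    rw [Nat.abs_cast, add_comm]
    push_cast
    rfl
  refine Summable.of_nat_of_neg (by simpa using h) (by simpa using h)

theorem summable_one_add_norm_latticePoint (d : ℕ) :
    Summable fun k : Fin d → ℤ => ((1 + ‖latticePoint k‖) ^ (2 * d))⁻¹ := by
  refine (summable_prod_apply (d := d) (fun j => by positivity)
    summable_one_add_abs_int_sq).of_nonneg_of_le (fun k => by positivity) fun k => ?_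
  rw [Finset.prod_inv_distrib]
  gcongr
  rw [pow_mul]
  calc ∏ i, (1 + |(k i : ℝ)|) ^ 2 ≤ ∏ _i : Fin d, (1 + ‖latticePoint k‖) ^ 2 := by
        refine Finset.prod_le_prod (fun i _ => by positivity) fun i _ => ?_
        gcongr
        exact PiLp.norm_apply_le (latticePoint k) i
    _ = _ := by simp

/-- The weight of the pair `(k, m)` of lattice points. -/
def gaborWeight {d : ℕ} (i : (Fin d → ℤ) × (Fin d → ℤ)) : ℝ :=
  (1 + ‖(1 / 4 : ℝ) • latticePoint i.1‖) * (1 + ‖latticePoint i.2‖)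

theorem one_le_gaborWeight {d : ℕ} (i : (Fin d → ℤ) × (Fin d → ℤ)) : 1 ≤ gaborWeight i :=
  one_le_mul_of_one_le_of_one_le (le_add_of_nonneg_right (norm_nonneg _))
    (le_add_of_nonneg_right (norm_nonneg _))

theorem summable_gaborWeight (d : ℕ) :
    Summable fun i : (Fin d → ℤ) × (Fin d → ℤ) => (gaborWeight i ^ (2 * d))⁻¹ := by
  have h := (summable_one_add_norm_latticePoint d).mul_of_nonneg
    (summable_one_add_norm_latticePoint d) (fun _ => by positivity) (fun _ => by positivity)
  refine (h.mul_left (4 ^ (2 * d))).of_nonneg_of_le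
    (fun i => inv_nonneg.2 (pow_nonneg (zero_le_one.trans (one_le_gaborWeight i)) _)) fun i => ?_
  rw [gaborWeight, mul_pow, mul_inv, ← mul_assoc]
  gcongr
  rw [← div_eq_mul_inv, inv_le_comm₀ (by positivity) (by positivity), inv_div, ← div_pow]
  gcongr
  rw [norm_smul, Real.norm_of_nonneg (by norm_num)]
  linarith [norm_nonneg (latticePoint i.1)]

end LatticeSums

/-! ### Fourier series of a localised Schwartz function -/

noncomputable section TorusFourierSeries

open FourierTransform

/-- A continuous function on the circle that is `x ↦ x` on `[0, 1/2]`. -/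
def torusCoord : C(UnitAddCircle, ℝ) where
  toFun := AddCircle.liftIoc 1 (-1 / 4) fun x => x * cutoff (-1) 2 x
  continuous_toFun := by
    refine AddCircle.liftIoc_continuous ?_
      (continuous_id.mul (contDiff_cutoff _ _).continuous).continuousOn
    rw [cutoff_eq_zero_of_le (by norm_num) (by norm_num),
      cutoff_eq_zero_of_ge (by norm_num) (by norm_num), mul_zero, mul_zero]

/-- The function `cutoff 0 1`, as a function on the circle. -/
def torusBump : C(UnitAddCircle, ℝ) where
  toFun := AddCircle.liftIoc 1 (-1 / 4) (cutoff 0 1)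
  continuous_toFun := by
    refine AddCircle.liftIoc_continuous ?_ (contDiff_cutoff _ _).continuous.continuousOn
    rw [cutoff_eq_zero_of_le (by norm_num) (by norm_num),
      cutoff_eq_zero_of_ge (by norm_num) (by norm_num)]

/-- The function `innerBump d * F`, as a function on the torus. -/
def torusFun {d : ℕ} (F : 𝓢(Rn d, ℂ)) : C(UnitAddTorus (Fin d), ℂ) where
  toFun t := ((∏ i, torusBump (t i) : ℝ) : ℂ) * F (WithLp.toLp 2 fun i => torusCoord (t i))
  continuous_toFun := by
    refine Continuous.mul ?_ (F.continuous.comp ?_)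
    · exact Complex.continuous_ofReal.comp (continuous_finsetProd _ fun i _ =>
        torusBump.continuous.comp (continuous_apply i))
    · exact (PiLp.continuous_toLp 2 _).comp (continuous_pi fun i =>
        torusCoord.continuous.comp (continuous_apply i))

theorem cutoff_ne_zero_bounds {x : ℝ} (h : cutoff 0 1 x ≠ 0) : 0 < 4 * x ∧ 4 * x < 2 := by
  refine ⟨lt_of_not_ge fun h' => h (cutoff_eq_zero_of_le zero_le_one h'),
    lt_of_not_ge fun h' => h (cutoff_eq_zero_of_ge zero_le_one (by linarith))⟩

/-- Where `innerBump` is nonzero, all coordinates lie in `(0, 1/2)` and there `torusCoord` is the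
identity; elsewhere both sides vanish. -/
theorem torusFun_coe {d : ℕ} (F : 𝓢(Rn d, ℂ)) {x : Fin d → ℝ}
    (hx : ∀ i, x i ∈ Set.Ioc (-1 / 4 : ℝ) (-1 / 4 + 1)) :
    torusFun F (fun i => (x i : UnitAddCircle)) =
      innerBump d (WithLp.toLp 2 x) * F (WithLp.toLp 2 x) := by
  have hb : ∀ i, torusBump (x i : UnitAddCircle) = cutoff 0 1 (x i) := fun i =>
    AddCircle.liftIoc_coe_apply (f := cutoff 0 1) (hx i)
  have hr : ∀ i, torusCoord (x i : UnitAddCircle) = x i * cutoff (-1) 2 (x i) := fun i =>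
    AddCircle.liftIoc_coe_apply (f := fun x => x * cutoff (-1) 2 x) (hx i)
  simp only [torusFun, ContinuousMap.coe_mk, hb, hr, innerBump_apply]
  by_cases h : ∀ i, cutoff 0 1 (x i) ≠ 0
  · have : ∀ i, x i * cutoff (-1) 2 (x i) = x i := fun i => by
      obtain ⟨h1, h2⟩ := cutoff_ne_zero_bounds (h i)
      rw [cutoff_eq_one (by linarith) (by linarith), mul_one]
    simp only [this]
  · push Not at h
    obtain ⟨i, hi⟩ := h
    rw [Finset.prod_eq_zero (Finset.mem_univ i) hi, Complex.ofReal_zero, zero_mul, zero_mul]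

theorem mFourier_coe {d : ℕ} (m : Fin d → ℤ) (x : Fin d → ℝ) :
    UnitAddTorus.mFourier m (fun i => (x i : UnitAddCircle)) =
      Real.fourierChar (inner ℝ (latticePoint m) (WithLp.toLp 2 x)) := by
  simp only [UnitAddTorus.mFourier, ContinuousMap.coe_mk, fourier_coe_apply,
    Real.fourierChar_apply, PiLp.inner_apply, latticePoint_apply]
  rw [← Complex.exp_sum]
  congr 1
  push_cast
  simp only [RCLike.inner_apply, conj_trivial, Finset.mul_sum, Finset.sum_mul]
  push_cast
  exact Finset.sum_congr rfl fun i _ => by ring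

theorem smulLeftCLM_innerBump_apply {d : ℕ} (F : 𝓢(Rn d, ℂ)) (x : Rn d) :
    SchwartzMap.smulLeftCLM ℂ (innerBump d) F x = innerBump d x * F x :=
  SchwartzMap.smulLeftCLM_apply_apply (innerBump d).hasTemperateGrowth F x

theorem innerBump_eq_zero {d : ℕ} {x : Rn d} {i : Fin d} (h : cutoff 0 1 (x i) = 0) :
    innerBump d x = 0 := by
  rw [innerBump_apply, Finset.prod_eq_zero (Finset.mem_univ i) h, Complex.ofReal_zero]

/-- The bump vanishes outside the fundamental cube `(-1/4, 3/4]^d`, so the integral over the cube is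
the Fourier integral over the whole space. -/
theorem mFourierCoeff_torusFun {d : ℕ} (F : 𝓢(Rn d, ℂ)) (m : Fin d → ℤ) :
    UnitAddTorus.mFourierCoeff (torusFun F) m =
      𝓕 (SchwartzMap.smulLeftCLM ℂ (innerBump d) F) (latticePoint m) := by
  rw [UnitAddTorus.mFourierCoeff_eq_integral _ _ fun _ => -1 / 4, SchwartzMap.fourier_coe,
    Real.fourier_eq, ← (PiLp.volume_preserving_toLp (Fin d)).integral_comp
      (MeasurableEquiv.toLp 2 _).measurableEmbedding]
  have hS : MeasurableSet {x : Fin d → ℝ | ∀ i, x i ∈ Set.Ioc (-1 / 4 : ℝ) (-1 / 4 + 1)} :=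
    MeasurableSet.univ_pi' fun _ => measurableSet_Ioc
  refine Eq.trans ?_ (MeasureTheory.setIntegral_eq_integral_of_forall_compl_eq_zero
    (s := {x : Fin d → ℝ | ∀ i, x i ∈ Set.Ioc (-1 / 4 : ℝ) (-1 / 4 + 1)}) ?_)
  · refine MeasureTheory.setIntegral_congr_fun hS fun x hx => ?_
    rw [torusFun_coe F hx, smulLeftCLM_innerBump_apply, mFourier_coe, Circle.smul_def]
    congr 3
    rw [real_inner_comm, ← inner_neg_right]
    congr 1
    ext i
    simp
  · intro x hx
    simp only [Set.mem_ofPred_eq, not_forall] at hx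
    obtain ⟨i, hi⟩ := hx
    rw [smulLeftCLM_innerBump_apply, innerBump_eq_zero (i := i), zero_mul, smul_zero]
    by_contra h
    obtain ⟨h1, h2⟩ := cutoff_ne_zero_bounds h
    simp only at h1 h2
    exact hi ⟨by linarith, by linarith⟩

theorem summable_apply_latticePoint {d : ℕ} (F : 𝓢(Rn d, ℂ)) :
    Summable fun m : Fin d → ℤ => F (latticePoint m) := by
  refine Summable.of_norm_bounded ((summable_one_add_norm_latticePoint d).mul_left
    (2 ^ (2 * d) * schwartzNorm (2 * d) F)) fun m => ?_
  rw [← div_eq_mul_inv, le_div_iff₀ (by positivity), mul_comm]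
  simpa using one_add_pow_mul_le_schwartzNorm le_rfl (Nat.zero_le _) F (latticePoint m)

/-- The Fourier series of `innerBump d * F`. -/
theorem hasSum_fourierSeries_innerBump {d : ℕ} (F : 𝓢(Rn d, ℂ)) (x : Rn d) :
    HasSum (fun m : Fin d → ℤ =>
      𝓕 (SchwartzMap.smulLeftCLM ℂ (innerBump d) F) (latticePoint m) *
        ((Real.fourierChar (inner ℝ (latticePoint m) x) : ℂ) * outerBump d x))
      (innerBump d x * F x) := by
  by_cases h : ∀ i, x i ∈ Set.Ioc (-1 / 4 : ℝ) (-1 / 4 + 1)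
  · have h1 := UnitAddTorus.hasSum_mFourier_series_apply_of_summable (f := torusFun F)
      (by
        rw [funext (mFourierCoeff_torusFun F)]
        exact summable_apply_latticePoint _) fun i => (x i : UnitAddCircle)
    rw [torusFun_coe F h] at h1
    -- The factor `outerBump` equals `1` where `innerBump` is nonzero. It truncates the periodic
    -- exponentials to Schwartz functions and removes the copies of the sum in the other cubes.
    have h2 := h1.mul_right (outerBump d x)
    have h3 : innerBump d x * F x * outerBump d x = innerBump d x * F x := by
      by_cases h4 : ∀ i, cutoff 0 1 (x i) ≠ 0
      · have : outerBump d x = 1 := by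
          rw [outerBump_apply, Finset.prod_eq_one, Complex.ofReal_one]
          intro i _
          obtain ⟨h1, h2⟩ := cutoff_ne_zero_bounds (h4 i)
          exact cutoff_eq_one (by linarith) (by linarith)
        rw [this, mul_one]
      · push Not at h4
        obtain ⟨i, hi⟩ := h4
        rw [innerBump_eq_zero hi, zero_mul, zero_mul]
    rw [show (WithLp.toLp 2 x.ofLp : Rn d) = x from rfl, h3] at h2
    refine h2.congr_fun fun m => ?_
    rw [mFourierCoeff_torusFun, mFourier_coe, smul_eq_mul, mul_assoc]
  · push Not at h
    obtain ⟨i, hi⟩ := h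
    have hi' : cutoff 0 1 (x i) = 0 ∧ cutoff (-1) 2 (x i) = 0 := by
      rw [Set.mem_Ioc, not_and_or, not_lt, not_le] at hi
      rcases hi with hi | hi
      · exact ⟨cutoff_eq_zero_of_le (by norm_num) (by linarith),
          cutoff_eq_zero_of_le (by norm_num) (by linarith)⟩
      · exact ⟨cutoff_eq_zero_of_ge (by norm_num) (by linarith),
          cutoff_eq_zero_of_ge (by norm_num) (by linarith)⟩
    rw [innerBump_eq_zero hi'.1, outerBump_apply,
      Finset.prod_eq_zero (Finset.mem_univ i) hi'.2]
    simp

end TorusFourierSeries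

/-! ### Gabor-type expansion of Schwartz functions -/

noncomputable section GaborExpansion

open FourierTransform

variable {d : ℕ}

/-- The coefficients of the expansion of a Schwartz function in the functions `gaborAtom`. -/
def gaborCoef (i : (Fin d → ℤ) × (Fin d → ℤ)) : 𝓢(Rn d, ℂ) →L[ℂ] ℂ :=
  (SchwartzMap.pointEvalCLM (latticePoint i.2)).comp ((fourierCLM ℂ 𝓢(Rn d, ℂ)).comp
    ((SchwartzMap.smulLeftCLM ℂ (innerBump d)).comp
      (SchwartzMap.compSubConstCLM ℂ (-((1 / 4 : ℝ) • latticePoint i.1)))))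

/-- The translate by `k/4` of the function `x ↦ exp (2 i π m·x) outerBump d x`, where
`i = (k, m)`. -/
def gaborAtom (i : (Fin d → ℤ) × (Fin d → ℤ)) : 𝓢(Rn d, ℂ) :=
  SchwartzMap.compSubConstCLM ℝ ((1 / 4 : ℝ) • latticePoint i.1)
    (𝓕⁻ (SchwartzMap.compSubConstCLM ℝ (latticePoint i.2) (𝓕 (outerBump d))))

theorem gaborCoef_apply (i : (Fin d → ℤ) × (Fin d → ℤ)) (f : 𝓢(Rn d, ℂ)) :
    gaborCoef i f = 𝓕 (SchwartzMap.smulLeftCLM ℂ (innerBump d)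
      (SchwartzMap.compSubConstCLM ℂ (-((1 / 4 : ℝ) • latticePoint i.1)) f))
        (latticePoint i.2) := rfl

theorem SchwartzMap.fourierInv_compSubConstCLM_apply (f : 𝓢(Rn d, ℂ)) (v x : Rn d) :
    𝓕⁻ (SchwartzMap.compSubConstCLM ℝ v f) x = (Real.fourierChar (inner ℝ v x) : ℂ) * 𝓕⁻ f x := by
  rw [SchwartzMap.fourierInv_coe, SchwartzMap.fourierInv_coe, Real.fourierInv_eq,
    Real.fourierInv_eq, ← MeasureTheory.integral_const_mul,
    ← MeasureTheory.integral_add_right_eq_self _ v]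
  refine MeasureTheory.integral_congr_ae (Filter.Eventually.of_forall fun y => ?_)
  simp only [SchwartzMap.compSubConstCLM_apply, add_sub_cancel_right, Circle.smul_def,
    inner_add_left, AddChar.map_add_eq_mul, Circle.coe_mul, smul_eq_mul]
  ring

theorem gaborAtom_apply (i : (Fin d → ℤ) × (Fin d → ℤ)) (x : Rn d) :
    gaborAtom i x =
      (Real.fourierChar (inner ℝ (latticePoint i.2) (x - (1 / 4 : ℝ) • latticePoint i.1)) : ℂ) *
        outerBump d (x - (1 / 4 : ℝ) • latticePoint i.1) := by
  rw [gaborAtom, SchwartzMap.compSubConstCLM_apply, SchwartzMap.fourierInv_compSubConstCLM_apply,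
    FourierTransform.fourierInv_fourier_eq]

/-- Decay in the position `k` comes from multiplying a translate of `f` by a fixed bump. Decay in
the frequency `m` comes from evaluating a Schwartz Fourier transform at `m`. -/
theorem exists_norm_gaborCoef_le (d N : ℕ) : ∃ (C : ℝ) (M : ℕ), 0 ≤ C ∧
    ∀ (i : (Fin d → ℤ) × (Fin d → ℤ)) (f : 𝓢(Rn d, ℂ)),
      gaborWeight i ^ N * ‖gaborCoef i f‖ ≤ C * schwartzNorm M f := by
  obtain ⟨C, M, hC, h⟩ := ContinuousLinearMap.exists_schwartzNorm_le
    (fourierCLM ℝ 𝓢(Rn d, ℂ)) N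
  obtain ⟨C', hC', h'⟩ := exists_schwartzNorm_mul_compSubConst_le (innerBump d) M N
  refine ⟨2 ^ N * C * C', M + N, by positivity, fun i f => ?_⟩
  set v : Rn d := (1 / 4 : ℝ) • latticePoint i.1
  set g := SchwartzMap.smulLeftCLM ℂ (innerBump d) (SchwartzMap.compSubConstCLM ℂ (-v) f)
  have h1 : (1 + ‖latticePoint i.2‖) ^ N * ‖gaborCoef i f‖ ≤ 2 ^ N * schwartzNorm N (𝓕 g) := by
    have := one_add_pow_mul_le_schwartzNorm le_rfl (Nat.zero_le N) (𝓕 g) (latticePoint i.2)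
    rwa [norm_iteratedFDeriv_zero] at this
  calc gaborWeight i ^ N * ‖gaborCoef i f‖
      = (1 + ‖v‖) ^ N * ((1 + ‖latticePoint i.2‖) ^ N * ‖gaborCoef i f‖) := by
        rw [gaborWeight, mul_pow, mul_assoc]
    _ ≤ (1 + ‖v‖) ^ N * (2 ^ N * (C * schwartzNorm M g)) := by
        exact mul_le_mul_of_nonneg_left
          (h1.trans (mul_le_mul_of_nonneg_left (h g) (by positivity))) (by positivity)
    _ = 2 ^ N * C * ((1 + ‖v‖) ^ N * schwartzNorm M g) := by ring
    _ ≤ 2 ^ N * C * (C' * schwartzNorm (M + N) f) := by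
        exact mul_le_mul_of_nonneg_left (h' v f) (by positivity)
    _ = _ := by ring

/-- Modulation is a translation on the Fourier side. Thus an atom results from two translations and
a continuous map, and each translation costs only a power of the weight. -/
theorem exists_schwartzNorm_gaborAtom_le (d N : ℕ) : ∃ (C : ℝ) (M : ℕ), 0 ≤ C ∧
    ∀ i : (Fin d → ℤ) × (Fin d → ℤ), schwartzNorm N (gaborAtom i) ≤ C * gaborWeight i ^ M := by
  obtain ⟨C, M, hC, h⟩ := ContinuousLinearMap.exists_schwartzNorm_le
    (fourierInvCLM ℝ 𝓢(Rn d, ℂ)) N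
  set B := schwartzNorm M (𝓕 (outerBump d)) with hB
  have hB0 : 0 ≤ B := schwartzNorm_nonneg _ _
  refine ⟨2 ^ N * C * 2 ^ M * B, max N M, by positivity, fun i => ?_⟩
  refine (schwartzNorm_compSubConstCLM_le N _ _).trans ?_
  have h1 := h (SchwartzMap.compSubConstCLM ℝ (latticePoint i.2) (𝓕 (outerBump d)))
  have h2 := schwartzNorm_compSubConstCLM_le M (latticePoint i.2) (𝓕 (outerBump d))
  have h3 : (1 : ℝ) ≤ 1 + ‖(1 / 4 : ℝ) • latticePoint i.1‖ :=
    le_add_of_nonneg_right (norm_nonneg _)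
  have h4 : (1 : ℝ) ≤ 1 + ‖latticePoint i.2‖ := le_add_of_nonneg_right (norm_nonneg _)
  calc _ ≤ 2 ^ N * (1 + ‖(1 / 4 : ℝ) • latticePoint i.1‖) ^ N *
        (C * (2 ^ M * (1 + ‖latticePoint i.2‖) ^ M * B)) := by
        gcongr
        exact h1.trans (mul_le_mul_of_nonneg_left h2 hC)
    _ ≤ 2 ^ N * (1 + ‖(1 / 4 : ℝ) • latticePoint i.1‖) ^ max N M *
        (C * (2 ^ M * (1 + ‖latticePoint i.2‖) ^ max N M * B)) := by
        gcongr
        · exact le_max_left _ _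
        · exact le_max_right _ _
    _ = _ := by
        rw [gaborWeight, mul_pow]
        ring

/-- A series with coefficients `gaborCoef i f` and terms that grow polynomially converges. -/
theorem exists_summable_gaborCoef_bound (d N : ℕ) : ∃ (b : ((Fin d → ℤ) × (Fin d → ℤ)) → ℝ)
    (M : ℕ), Summable b ∧ ∀ (f : 𝓢(Rn d, ℂ)) (i : (Fin d → ℤ) × (Fin d → ℤ)),
      ‖gaborCoef i f‖ * gaborWeight i ^ N ≤ b i * schwartzNorm M f := by
  -- The `2 * d` additional powers of the weight pay for summability over the double lattice.
  obtain ⟨C, M, hC, h⟩ := exists_norm_gaborCoef_le d (N + 2 * d)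
  refine ⟨fun i => C * (gaborWeight i ^ (2 * d))⁻¹, M, (summable_gaborWeight d).mul_left C,
    fun f i => ?_⟩
  have h1 : 0 < gaborWeight i ^ (2 * d) :=
    pow_pos (zero_lt_one.trans_le (one_le_gaborWeight i)) _
  rw [mul_right_comm, ← div_eq_mul_inv, le_div_iff₀ h1, mul_assoc, ← pow_add, mul_comm]
  exact h i f

/-- The atoms are replaced by arbitrary Schwartz functions of polynomial growth in the index, so
that an operator can be built from its prescribed values on atoms. -/
theorem summable_gaborCoef_smul {E F : Type*} [NormedAddCommGroup E] [NormedSpace ℝ E]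
    [NormedAddCommGroup F] [NormedSpace ℂ F] [CompleteSpace F]
    {g : (Fin d → ℤ) × (Fin d → ℤ) → 𝓢(E, F)}
    (hg : ∀ N, ∃ (C : ℝ) (M : ℕ), 0 ≤ C ∧ ∀ i, schwartzNorm N (g i) ≤ C * gaborWeight i ^ M)
    (N : ℕ) : ∃ (C : ℝ) (M : ℕ), 0 ≤ C ∧ ∀ f : 𝓢(Rn d, ℂ),
      (Summable fun i => schwartzNorm N (gaborCoef i f • g i)) ∧
        ∑' i, schwartzNorm N (gaborCoef i f • g i) ≤ C * schwartzNorm M f := by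
  obtain ⟨C, M, hC, h⟩ := hg N
  obtain ⟨b, M', hb, hbd⟩ := exists_summable_gaborCoef_bound d M
  have hle : ∀ (f : 𝓢(Rn d, ℂ)) i,
      schwartzNorm N (gaborCoef i f • g i) ≤ b i * (C * schwartzNorm M' f) := by
    intro f i
    have hs : schwartzNorm N (gaborCoef i f • g i) ≤ ‖gaborCoef i f‖ * schwartzNorm N (g i) := by
      refine schwartzNorm_le (mul_nonneg (norm_nonneg _) (schwartzNorm_nonneg _ _))
        fun k hk l hl x => ?_
      have : iteratedFDeriv ℝ l (⇑(gaborCoef i f • g i)) x =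
          gaborCoef i f • iteratedFDeriv ℝ l (g i) x :=
        iteratedFDeriv_const_smul_apply (SchwartzMap.smooth _ _).contDiffAt
      rw [this, norm_smul, mul_left_comm]
      exact mul_le_mul_of_nonneg_left ((SchwartzMap.le_seminorm ℝ k l (g i) x).trans
        (seminorm_le_schwartzNorm hk hl _)) (norm_nonneg _)
    calc _ ≤ ‖gaborCoef i f‖ * (C * gaborWeight i ^ M) :=
          hs.trans (mul_le_mul_of_nonneg_left (h i) (norm_nonneg _))
      _ = C * (‖gaborCoef i f‖ * gaborWeight i ^ M) := by ring
      _ ≤ C * (b i * schwartzNorm M' f) := mul_le_mul_of_nonneg_left (hbd f i) hC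
      _ = _ := by ring
  have hs : ∀ f : 𝓢(Rn d, ℂ), Summable fun i => schwartzNorm N (gaborCoef i f • g i) := fun f =>
    (hb.mul_right _).of_nonneg_of_le (fun i => schwartzNorm_nonneg _ _) (hle f)
  refine ⟨|∑' i, b i| * C, M', by positivity, fun f => ⟨hs f, ?_⟩⟩
  refine ((hs f).tsum_le_tsum (hle f) (hb.mul_right _)).trans ?_
  rw [tsum_mul_right, ← mul_assoc]
  have := schwartzNorm_nonneg M' f
  gcongr
  exact le_abs_self _

/-- The expansion of a Schwartz function. -/
theorem hasSum_gaborCoef_smul_gaborAtom (f : 𝓢(Rn d, ℂ)) :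
    HasSum (fun i => gaborCoef i f • gaborAtom i) f := by
  have hs : Summable fun i => gaborCoef i f • gaborAtom i :=
    summable_of_summable_schwartzNorm fun N => by
      obtain ⟨C, M, -, h⟩ := summable_gaborCoef_smul (exists_schwartzNorm_gaborAtom_le d) N
      exact (h f).1
  convert hs.hasSum
  ext x
  have hx := (SchwartzMap.pointEvalCLM x).hasSum hs.hasSum
  simp only [SchwartzMap.pointEvalCLM_apply, smul_apply, smul_eq_mul] at hx
  -- For fixed `k`, the sum over `m` is the Fourier series of the piece of `f` near `k/4`. The sum
  -- over `k` then uses the partition of unity.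
  refine HasSum.unique ?_ (hx.prod_fiberwise fun k => ?_) (f := fun k : Fin d → ℤ =>
    innerBump d (x - (1 / 4 : ℝ) • latticePoint k) * f x)
  · simpa using (hasSum_innerBump x).mul_right (f x)
  · have := hasSum_fourierSeries_innerBump (SchwartzMap.compSubConstCLM ℂ
      (-((1 / 4 : ℝ) • latticePoint k)) f) (x - (1 / 4 : ℝ) • latticePoint k)
    rw [SchwartzMap.compSubConstCLM_apply, sub_neg_eq_add, sub_add_cancel] at this
    refine this.congr_fun fun m => ?_
    rw [gaborCoef_apply, gaborAtom_apply]

end GaborExpansion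

/-! ### The decomposition of `ℝ^{2n}` into two factors -/

noncomputable section PairCoordinates

open MeasureTheory

variable {n : ℕ}

/-- The projection `(x, y) ↦ x`. -/
def pairFst : Rn (n + n) →L[ℝ] Rn n :=
  LinearMap.toContinuousLinearMap
    { toFun := fun z => WithLp.toLp 2 fun i => z (Fin.castAdd n i)
      map_add' := fun _ _ => rfl
      map_smul' := fun _ _ => rfl }

/-- The projection `(x, y) ↦ y`. -/
def pairSnd : Rn (n + n) →L[ℝ] Rn n :=
  LinearMap.toContinuousLinearMap
    { toFun := fun z => WithLp.toLp 2 fun i => z (Fin.natAdd n i)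
      map_add' := fun _ _ => rfl
      map_smul' := fun _ _ => rfl }

@[simp]
theorem pairFst_apply (z : Rn (n + n)) (i : Fin n) : pairFst z i = z (Fin.castAdd n i) := rfl

@[simp]
theorem pairSnd_apply (z : Rn (n + n)) (i : Fin n) : pairSnd z i = z (Fin.natAdd n i) := rfl

@[simp]
theorem pair_castAdd (x y : Rn n) (i : Fin n) : pair x y (Fin.castAdd n i) = x i :=
  Fin.append_left _ _ i

@[simp]
theorem pair_natAdd (x y : Rn n) (i : Fin n) : pair x y (Fin.natAdd n i) = y i :=
  Fin.append_right _ _ i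

@[simp]
theorem pairFst_pair (x y : Rn n) : pairFst (pair x y) = x := by
  ext i; simp

@[simp]
theorem pairSnd_pair (x y : Rn n) : pairSnd (pair x y) = y := by
  ext i; simp

@[simp]
theorem pair_pairFst_pairSnd (z : Rn (n + n)) : pair (pairFst z) (pairSnd z) = z := by
  ext i
  refine Fin.addCases (fun i => ?_) (fun i => ?_) i <;> simp [-Fin.natAdd_eq_addNat]

theorem pair_add (x y x' y' : Rn n) : pair (x + x') (y + y') = pair x y + pair x' y' := by
  ext i
  refine Fin.addCases (fun i => ?_) (fun i => ?_) i <;> simp [-Fin.natAdd_eq_addNat]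

theorem pair_sub (x y x' y' : Rn n) : pair (x - x') (y - y') = pair x y - pair x' y' := by
  ext i
  refine Fin.addCases (fun i => ?_) (fun i => ?_) i <;> simp [-Fin.natAdd_eq_addNat]

theorem pair_smul (c : ℝ) (x y : Rn n) : pair (c • x) (c • y) = c • pair x y := by
  ext i
  refine Fin.addCases (fun i => ?_) (fun i => ?_) i <;> simp [-Fin.natAdd_eq_addNat]

theorem inner_pair (x y x' y' : Rn n) :
    inner ℝ (pair x y) (pair x' y') = inner ℝ x x' + inner ℝ y y' := by
  simp [PiLp.inner_apply, Fin.sum_univ_add, -Fin.natAdd_eq_addNat]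

theorem norm_sq_pair (x y : Rn n) : ‖pair x y‖ ^ 2 = ‖x‖ ^ 2 + ‖y‖ ^ 2 := by
  rw [← real_inner_self_eq_norm_sq, inner_pair, real_inner_self_eq_norm_sq,
    real_inner_self_eq_norm_sq]

theorem norm_fst_le_norm_pair (x y : Rn n) : ‖x‖ ≤ ‖pair x y‖ := by
  refine le_of_sq_le_sq ?_ (norm_nonneg _)
  rw [norm_sq_pair]
  exact le_add_of_nonneg_right (sq_nonneg _)

theorem norm_snd_le_norm_pair (x y : Rn n) : ‖y‖ ≤ ‖pair x y‖ := by
  refine le_of_sq_le_sq ?_ (norm_nonneg _)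
  rw [norm_sq_pair]
  exact le_add_of_nonneg_left (sq_nonneg _)

theorem norm_pair_le (x y : Rn n) : ‖pair x y‖ ≤ ‖x‖ + ‖y‖ := by
  refine le_of_sq_le_sq ?_ (by positivity)
  rw [norm_sq_pair]
  nlinarith [mul_nonneg (norm_nonneg x) (norm_nonneg y)]

theorem norm_pairFst_le : ‖(pairFst : Rn (n + n) →L[ℝ] Rn n)‖ ≤ 1 :=
  ContinuousLinearMap.opNorm_le_bound _ zero_le_one fun z => by
    simpa using norm_fst_le_norm_pair (pairFst z) (pairSnd z)

theorem norm_pairSnd_le : ‖(pairSnd : Rn (n + n) →L[ℝ] Rn n)‖ ≤ 1 :=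
  ContinuousLinearMap.opNorm_le_bound _ zero_le_one fun z => by
    simpa using norm_snd_le_norm_pair (pairFst z) (pairSnd z)

/-- The isometry `(x, y) ↦ pair x y`. -/
def pairIsometry (n : ℕ) : WithLp 2 (Rn n × Rn n) ≃ₗᵢ[ℝ] Rn (n + n) where
  toFun p := pair p.fst p.snd
  invFun z := WithLp.toLp 2 (pairFst z, pairSnd z)
  map_add' p q := pair_add _ _ _ _
  map_smul' c p := pair_smul c _ _
  left_inv p := by simp only [pairFst_pair, pairSnd_pair]; rfl
  right_inv z := by simp
  norm_map' p := by
    have h : ‖pair p.fst p.snd‖ ^ 2 = ‖p‖ ^ 2 := by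
      rw [norm_sq_pair, WithLp.prod_norm_sq_eq_of_L2]
    exact (sq_eq_sq₀ (norm_nonneg _) (norm_nonneg _)).1 h

theorem measurePreserving_pair :
    MeasurePreserving (fun p : Rn n × Rn n => pair p.1 p.2) (volume.prod volume) volume :=
  (pairIsometry n).measurePreserving.comp (WithLp.volume_preserving_toLp _ _)

theorem integral_mul_pairFst_pairSnd (f g : Rn n → ℂ) :
    ∫ z : Rn (n + n), f (pairFst z) * g (pairSnd z) = (∫ x, f x) * ∫ y, g y := by
  have hm : MeasurableEmbedding fun p : Rn n × Rn n => pair p.1 p.2 :=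
    ((MeasurableEquiv.toLp 2 (Rn n × Rn n)).trans
      (pairIsometry n).toHomeomorph.toMeasurableEquiv).measurableEmbedding
  rw [← measurePreserving_pair.integral_comp hm]
  simp only [pairFst_pair, pairSnd_pair]
  exact integral_prod_mul f g

end PairCoordinates

/-! ### Tensor products of Schwartz functions and of atoms -/

noncomputable section Tensor

open FourierTransform MeasureTheory

variable {n : ℕ}

theorem norm_pow_mul_iteratedFDeriv_tensor_le (f g : 𝓢(Rn n, ℂ)) {N k l : ℕ} (hk : k ≤ N)
    (hl : l ≤ N) (z : Rn (n + n)) :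
    ‖z‖ ^ k * ‖iteratedFDeriv ℝ l (fun z => f (pairFst z) * g (pairSnd z)) z‖ ≤
      2 ^ N * (2 ^ N * schwartzNorm N f) * (2 ^ N * schwartzNorm N g) := by
  have hf : ContDiff ℝ ∞ fun z : Rn (n + n) => f (pairFst z) := (f.smooth ⊤).comp pairFst.contDiff
  have hg : ContDiff ℝ ∞ fun z : Rn (n + n) => g (pairSnd z) := (g.smooth ⊤).comp pairSnd.contDiff
  have hcomp : ∀ (h : 𝓢(Rn n, ℂ)) (L : Rn (n + n) →L[ℝ] Rn n), ‖L‖ ≤ 1 → ∀ i,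
      ‖iteratedFDeriv ℝ i (fun z => h (L z)) z‖ ≤ ‖iteratedFDeriv ℝ i h (L z)‖ := by
    intro h L hL i
    have h1 : iteratedFDeriv ℝ i (⇑h ∘ L) z = _ :=
      L.iteratedFDeriv_comp_right (h.smooth ⊤) z (i := i) (mod_cast le_top)
    refine (congrArg norm h1).le.trans ?_
    refine (ContinuousMultilinearMap.norm_compContinuousLinearMap_le _ _).trans ?_
    refine mul_le_of_le_one_right (norm_nonneg _) ?_
    exact Finset.prod_le_one (fun _ _ => norm_nonneg _) fun _ _ => hL
  have hz : ‖z‖ ≤ (1 + ‖pairFst z‖) * (1 + ‖pairSnd z‖) := by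
    have := norm_pair_le (pairFst z) (pairSnd z)
    rw [pair_pairFst_pairSnd] at this
    nlinarith [norm_nonneg (pairFst z), norm_nonneg (pairSnd z)]
  have hf0 := schwartzNorm_nonneg N f
  have hg0 := schwartzNorm_nonneg N g
  calc _ ≤ ((1 + ‖pairFst z‖) * (1 + ‖pairSnd z‖)) ^ k *
        ∑ i ∈ Finset.range (l + 1), (l.choose i : ℝ) * ‖iteratedFDeriv ℝ i f (pairFst z)‖ *
          ‖iteratedFDeriv ℝ (l - i) g (pairSnd z)‖ := by
        gcongr
        refine (norm_iteratedFDeriv_mul_le hf hg z (n := l) (mod_cast le_top)).trans ?_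
        refine Finset.sum_le_sum fun i _ => ?_
        have h1 := hcomp f pairFst norm_pairFst_le i
        have h2 := hcomp g pairSnd norm_pairSnd_le (l - i)
        gcongr
    _ = ∑ i ∈ Finset.range (l + 1), (l.choose i : ℝ) *
          ((1 + ‖pairFst z‖) ^ k * ‖iteratedFDeriv ℝ i f (pairFst z)‖) *
            ((1 + ‖pairSnd z‖) ^ k * ‖iteratedFDeriv ℝ (l - i) g (pairSnd z)‖) := by
        rw [Finset.mul_sum]
        refine Finset.sum_congr rfl fun i _ => ?_
        rw [mul_pow]
        ring
    _ ≤ ∑ i ∈ Finset.range (l + 1), (l.choose i : ℝ) * (2 ^ N * schwartzNorm N f) *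
          (2 ^ N * schwartzNorm N g) := by
        refine Finset.sum_le_sum fun i hi => ?_
        have hi' : i ≤ l := Finset.mem_range_succ_iff.1 hi
        have h1 := one_add_pow_mul_le_schwartzNorm (l := i) hk (by omega) f (pairFst z)
        have h2 := one_add_pow_mul_le_schwartzNorm (l := l - i) hk (by omega) g (pairSnd z)
        gcongr
    _ = 2 ^ l * (2 ^ N * schwartzNorm N f) * (2 ^ N * schwartzNorm N g) := by
        rw [← Finset.sum_mul, ← Finset.sum_mul]
        have : (∑ i ∈ Finset.range (l + 1), (l.choose i : ℝ)) = 2 ^ l := by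
          exact_mod_cast Nat.sum_range_choose l
        rw [this]
    _ ≤ _ := by
        gcongr
        norm_num

/-- The tensor product `(x, y) ↦ f x * g y` of two Schwartz functions. -/
def schwartzTensor (f g : 𝓢(Rn n, ℂ)) : 𝓢(Rn (n + n), ℂ) where
  toFun z := f (pairFst z) * g (pairSnd z)
  smooth' := ((f.smooth ⊤).comp pairFst.contDiff).mul ((g.smooth ⊤).comp pairSnd.contDiff)
  decay' k l := ⟨_, norm_pow_mul_iteratedFDeriv_tensor_le f g (le_max_left k l) (le_max_right k l)⟩

theorem schwartzTensor_apply (f g : 𝓢(Rn n, ℂ)) (z : Rn (n + n)) :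
    schwartzTensor f g z = f (pairFst z) * g (pairSnd z) := rfl

theorem schwartzTensor_pair (f g : 𝓢(Rn n, ℂ)) (x y : Rn n) :
    schwartzTensor f g (pair x y) = f x * g y := by
  rw [schwartzTensor_apply, pairFst_pair, pairSnd_pair]

theorem eq_schwartzTensor {F : 𝓢(Rn (n + n), ℂ)} {f g : 𝓢(Rn n, ℂ)}
    (h : ∀ x y, F (pair x y) = f x * g y) : F = schwartzTensor f g := by
  ext z
  rw [schwartzTensor_apply, ← h, pair_pairFst_pairSnd]

theorem schwartzNorm_schwartzTensor_le (N : ℕ) (f g : 𝓢(Rn n, ℂ)) :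
    schwartzNorm N (schwartzTensor f g) ≤
      2 ^ N * (2 ^ N * schwartzNorm N f) * (2 ^ N * schwartzNorm N g) := by
  have hf0 := schwartzNorm_nonneg N f
  have hg0 := schwartzNorm_nonneg N g
  exact schwartzNorm_le (by positivity) fun k hk l hl z =>
    norm_pow_mul_iteratedFDeriv_tensor_le f g hk hl z

theorem fourier_schwartzTensor_pair (f g : 𝓢(Rn n, ℂ)) (ξ η : Rn n) :
    𝓕 (schwartzTensor f g) (pair ξ η) = 𝓕 f ξ * 𝓕 g η := by
  rw [SchwartzMap.fourier_coe, SchwartzMap.fourier_coe, SchwartzMap.fourier_coe, Real.fourier_eq,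
    Real.fourier_eq, Real.fourier_eq, ← integral_mul_pairFst_pairSnd]
  refine integral_congr_ae (Filter.Eventually.of_forall fun z => ?_)
  simp only [schwartzTensor_apply]
  conv_lhs => rw [← pair_pairFst_pairSnd z]
  rw [inner_pair, pairFst_pair, pairSnd_pair, neg_add, AddChar.map_add_eq_mul, Circle.smul_def,
    Circle.smul_def, Circle.smul_def, Circle.coe_mul]
  simp only [smul_eq_mul]
  ring

/-- Lattice points of `ℝ^{2n}` as pairs of lattice points of `ℝ^n`. -/
def gaborIndexEquiv (n : ℕ) : ((Fin n → ℤ) × (Fin n → ℤ)) × ((Fin n → ℤ) × (Fin n → ℤ)) ≃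
    (Fin (n + n) → ℤ) × (Fin (n + n) → ℤ) :=
  (Equiv.prodProdProdComm _ _ _ _).trans
    (Equiv.prodCongr (Fin.appendEquiv n n) (Fin.appendEquiv n n))

theorem latticePoint_append (k l : Fin n → ℤ) :
    latticePoint (Fin.append k l) = pair (latticePoint k) (latticePoint l) := by
  ext i
  refine Fin.addCases (fun i => ?_) (fun i => ?_) i <;> simp [-Fin.natAdd_eq_addNat]

theorem latticePoint_gaborIndexEquiv_fst (i j : (Fin n → ℤ) × (Fin n → ℤ)) :
    latticePoint (gaborIndexEquiv n (i, j)).1 = pair (latticePoint i.1) (latticePoint j.1) :=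
  latticePoint_append _ _

theorem latticePoint_gaborIndexEquiv_snd (i j : (Fin n → ℤ) × (Fin n → ℤ)) :
    latticePoint (gaborIndexEquiv n (i, j)).2 = pair (latticePoint i.2) (latticePoint j.2) :=
  latticePoint_append _ _

theorem gaborWeight_fst_le (i j : (Fin n → ℤ) × (Fin n → ℤ)) :
    gaborWeight i ≤ gaborWeight (gaborIndexEquiv n (i, j)) := by
  unfold gaborWeight
  rw [latticePoint_gaborIndexEquiv_fst, latticePoint_gaborIndexEquiv_snd, ← pair_smul]
  gcongr
  · exact norm_fst_le_norm_pair _ _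
  · exact norm_fst_le_norm_pair _ _

theorem gaborWeight_snd_le (i j : (Fin n → ℤ) × (Fin n → ℤ)) :
    gaborWeight j ≤ gaborWeight (gaborIndexEquiv n (i, j)) := by
  unfold gaborWeight
  rw [latticePoint_gaborIndexEquiv_fst, latticePoint_gaborIndexEquiv_snd, ← pair_smul]
  gcongr
  · exact norm_snd_le_norm_pair _ _
  · exact norm_snd_le_norm_pair _ _

theorem innerBump_pair (x y : Rn n) :
    innerBump (n + n) (pair x y) = innerBump n x * innerBump n y := by
  simp [innerBump_apply, Fin.prod_univ_add, -Fin.natAdd_eq_addNat]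

theorem outerBump_pair (x y : Rn n) :
    outerBump (n + n) (pair x y) = outerBump n x * outerBump n y := by
  simp [outerBump_apply, Fin.prod_univ_add, -Fin.natAdd_eq_addNat]

/-- Characters, bumps and lattice translations all factor over the two copies of `ℝ^n`. Combined
with the expansion on `ℝ^{2n}`, this shows that tensor products span a dense subspace. -/
theorem gaborAtom_gaborIndexEquiv (i j : (Fin n → ℤ) × (Fin n → ℤ)) :
    gaborAtom (gaborIndexEquiv n (i, j)) = schwartzTensor (gaborAtom i) (gaborAtom j) := by
  refine eq_schwartzTensor fun x y => ?_
  rw [gaborAtom_apply, gaborAtom_apply, gaborAtom_apply, latticePoint_gaborIndexEquiv_fst,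
    latticePoint_gaborIndexEquiv_snd, ← pair_smul, ← pair_sub, inner_pair, outerBump_pair,
    AddChar.map_add_eq_mul, Circle.coe_mul]
  ring

theorem gaborCoef_gaborIndexEquiv (i j : (Fin n → ℤ) × (Fin n → ℤ)) (f g : 𝓢(Rn n, ℂ)) :
    gaborCoef (gaborIndexEquiv n (i, j)) (schwartzTensor f g) = gaborCoef i f * gaborCoef j g := by
  rw [gaborCoef_apply, gaborCoef_apply, gaborCoef_apply, latticePoint_gaborIndexEquiv_fst,
    latticePoint_gaborIndexEquiv_snd, ← fourier_schwartzTensor_pair]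
  congr 2
  refine eq_schwartzTensor fun x y => ?_
  simp only [smulLeftCLM_innerBump_apply, SchwartzMap.compSubConstCLM_apply, sub_neg_eq_add,
    innerBump_pair]
  rw [← pair_smul, ← pair_add, schwartzTensor_pair]
  ring

/-- Continuous linear maps that agree on tensor products agree. -/
theorem eq_of_forall_schwartzTensor {V : Type*} [AddCommGroup V] [Module ℂ V] [TopologicalSpace V]
    [T2Space V] {u v : 𝓢(Rn (n + n), ℂ) →L[ℂ] V}
    (h : ∀ f g, u (schwartzTensor f g) = v (schwartzTensor f g)) : u = v := by
  ext F
  have h1 := u.hasSum (hasSum_gaborCoef_smul_gaborAtom F)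
  have h2 := v.hasSum (hasSum_gaborCoef_smul_gaborAtom F)
  refine h1.unique (h2.congr_fun fun i => ?_)
  obtain ⟨⟨i, j⟩, rfl⟩ := (gaborIndexEquiv n).surjective i
  rw [map_smul, map_smul, gaborAtom_gaborIndexEquiv, h]

end Tensor

/-! ### Functionals and operators given by their values on atoms -/

noncomputable section GaborSeriesOperators

variable {d : ℕ}

theorem continuous_of_norm_le_schwartzNorm {E F G : Type*} [NormedAddCommGroup E]
    [NormedSpace ℝ E] [NormedAddCommGroup F] [NormedSpace ℝ F] [NormedAddCommGroup G]
    [NormedSpace ℝ G] (T : 𝓢(E, F) →ₗ[ℝ] G) {C : ℝ} {M : ℕ}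
    (h : ∀ f, ‖T f‖ ≤ C * schwartzNorm M f) : Continuous T := by
  refine continuous_of_continuousAt_zero T ?_
  rw [ContinuousAt, map_zero]
  refine squeeze_zero_norm h ?_
  have := (continuous_schwartzNorm (E := E) (F := F) M).tendsto 0
  rw [map_zero] at this
  simpa using this.const_mul C

theorem exists_gaborCoef_series_functional {a : (Fin d → ℤ) × (Fin d → ℤ) → ℂ} {C : ℝ} {N : ℕ}
    (ha : ∀ i, ‖a i‖ ≤ C * gaborWeight i ^ N) :
    ∃ u : 𝓢(Rn d, ℂ) →L[ℂ] ℂ, ∀ f, HasSum (fun i => gaborCoef i f * a i) (u f) := by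
  obtain ⟨b, M, hb, hbd⟩ := exists_summable_gaborCoef_bound d N
  have hC : 0 ≤ C := by
    have h1 := (norm_nonneg _).trans (ha 0)
    exact nonneg_of_mul_nonneg_left h1
      (pow_pos (zero_lt_one.trans_le (one_le_gaborWeight 0)) N)
  have hle : ∀ (f : 𝓢(Rn d, ℂ)) i,
      ‖gaborCoef i f * a i‖ ≤ b i * (C * schwartzNorm M f) := fun f i => by
    rw [norm_mul]
    calc _ ≤ ‖gaborCoef i f‖ * (C * gaborWeight i ^ N) :=
          mul_le_mul_of_nonneg_left (ha i) (norm_nonneg _)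
      _ = C * (‖gaborCoef i f‖ * gaborWeight i ^ N) := by ring
      _ ≤ C * (b i * schwartzNorm M f) := mul_le_mul_of_nonneg_left (hbd f i) hC
      _ = _ := by ring
  have hs : ∀ f : 𝓢(Rn d, ℂ), Summable fun i => gaborCoef i f * a i := fun f =>
    Summable.of_norm_bounded (hb.mul_right _) (hle f)
  let T : 𝓢(Rn d, ℂ) →ₗ[ℂ] ℂ :=
    { toFun := fun f => ∑' i, gaborCoef i f * a i
      map_add' := fun f g => by
        simp only [map_add, add_mul]
        exact (hs f).tsum_add (hs g)
      map_smul' := fun c f => by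
        simp only [map_smul, smul_eq_mul, mul_assoc, RingHom.id_apply]
        exact tsum_mul_left }
  have hT : Continuous T := by
    refine continuous_of_norm_le_schwartzNorm (T.restrictScalars ℝ) (C := (∑' i, b i) * C)
      (M := M) fun f => ?_
    refine (tsum_of_norm_bounded (hb.mul_right _).hasSum (hle f)).trans (le_of_eq ?_)
    rw [tsum_mul_right, mul_assoc]
  exact ⟨⟨T, hT⟩, fun f => (hs f).hasSum⟩

theorem exists_gaborCoef_series_operator {e : ℕ}
    {g : (Fin d → ℤ) × (Fin d → ℤ) → 𝓢(Rn e, ℂ)}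
    (hg : ∀ N, ∃ (C : ℝ) (M : ℕ), 0 ≤ C ∧ ∀ i, schwartzNorm N (g i) ≤ C * gaborWeight i ^ M) :
    ∃ T : 𝓢(Rn d, ℂ) →L[ℂ] 𝓢(Rn e, ℂ), ∀ f, HasSum (fun i => gaborCoef i f • g i) (T f) := by
  have hs : ∀ f : 𝓢(Rn d, ℂ), Summable fun i => gaborCoef i f • g i := fun f =>
    summable_of_summable_schwartzNorm fun N => by
      obtain ⟨C, M, -, h⟩ := summable_gaborCoef_smul hg N
      exact (h f).1
  let T : 𝓢(Rn d, ℂ) →ₗ[ℂ] 𝓢(Rn e, ℂ) :=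
    { toFun := fun f => ∑' i, gaborCoef i f • g i
      map_add' := fun f h => by
        simp only [map_add, add_smul]
        exact (hs f).tsum_add (hs h)
      map_smul' := fun c f => by
        simp only [map_smul, smul_eq_mul, mul_smul, RingHom.id_apply]
        exact (hs f).tsum_const_smul c }
  have hT : Continuous T := by
    refine continuous_of_schwartzNorm_le (T.restrictScalars ℝ) fun N => ?_
    obtain ⟨C, M, -, h⟩ := summable_gaborCoef_smul hg N
    exact ⟨C, M, fun f => (Seminorm.le_tsum_of_hasSum (continuous_schwartzNorm N)
      (hs f).hasSum (h f).1).trans (h f).2⟩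
  exact ⟨⟨T, hT⟩, fun f => (hs f).hasSum⟩

end GaborSeriesOperators

/-! ### The Schwartz kernel theorem -/

noncomputable section KernelTheorem

open Filter Topology

variable {n : ℕ}

/-- The value of a tempered distribution, as a continuous linear form. -/
def distributionCLM {d : ℕ} (u : 𝓢'(Rn d, ℂ)) : 𝓢(Rn d, ℂ) →L[ℂ] ℂ := u

@[simp]
theorem distributionCLM_apply {d : ℕ} (u : 𝓢'(Rn d, ℂ)) (f : 𝓢(Rn d, ℂ)) :
    distributionCLM u f = u f := rfl

theorem exists_norm_distribution_gaborAtom_le (u : 𝓢'(Rn n, ℂ)) : ∃ (C : ℝ) (N : ℕ),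
    ∀ j, ‖u (gaborAtom j)‖ ≤ C * gaborWeight j ^ N := by
  obtain ⟨C, N, hC, h⟩ := ContinuousLinearMap.exists_norm_le_schwartzNorm
    ((distributionCLM u).restrictScalars ℝ)
  obtain ⟨C', M, -, h'⟩ := exists_schwartzNorm_gaborAtom_le n N
  refine ⟨C * C', M, fun j => (h (gaborAtom j)).trans ?_⟩
  rw [mul_assoc]
  exact mul_le_mul_of_nonneg_left (h' j) hC

theorem exists_schwartzNorm_lt_subset {E F : Type*} [NormedAddCommGroup E] [NormedSpace ℝ E]
    [NormedAddCommGroup F] [NormedSpace ℝ F] {V : Set 𝓢(E, F)} (hV : V ∈ 𝓝 0) :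
    ∃ (M : ℕ) (r : ℝ), 0 < r ∧ ∀ f, schwartzNorm M f < r → f ∈ V := by
  obtain ⟨⟨s, r⟩, hr, hs⟩ := (schwartz_withSeminorms ℝ E F).hasBasis_zero_ball.mem_iff.1 hV
  refine ⟨s.sup fun i => max i.1 i.2, r, hr, fun f hf => hs ?_⟩
  rw [Seminorm.mem_ball_zero]
  refine lt_of_le_of_lt (Seminorm.finset_sup_apply_le (schwartzNorm_nonneg _ _) fun i hi => ?_) hf
  have := Finset.le_sup (f := fun i : ℕ × ℕ => max i.1 i.2) hi
  exact seminorm_le_schwartzNorm ((le_max_left _ _).trans this) ((le_max_right _ _).trans this) f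

theorem continuous_operator_apply (A : 𝓢(Rn n, ℂ) →L[ℂ] 𝓢'(Rn n, ℂ)) (g : 𝓢(Rn n, ℂ)) :
    Continuous fun f => A f g :=
  ((PointwiseConvergenceCLM.evalCLM (RingHom.id ℂ) ℂ g).comp A).continuous

/-- By the Baire category theorem, the matrix of a continuous operator grows polynomially. -/
theorem exists_norm_operator_gaborAtom_le (A : 𝓢(Rn n, ℂ) →L[ℂ] 𝓢'(Rn n, ℂ)) :
    ∃ (C : ℝ) (N : ℕ), 0 ≤ C ∧ ∀ i j,
      ‖A (gaborAtom i) (gaborAtom j)‖ ≤ C * gaborWeight i ^ N * gaborWeight j ^ N := by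
  -- One integer serves as constant and as exponent, which keeps the cover countable. Each set is
  -- closed by pointwise continuity of `A`, and the sets cover everything because each `A f` is a
  -- tempered distribution.
  let S : ℕ → Set 𝓢(Rn n, ℂ) := fun N => {f | ∀ j, ‖A f (gaborAtom j)‖ ≤ N * gaborWeight j ^ N}
  have hSc : ∀ N, IsClosed (S N) := fun N => by
    simp only [S, Set.ofPred_forall]
    exact isClosed_iInter fun j =>
      isClosed_le (continuous_operator_apply A _).norm continuous_const
  have hSU : ⋃ N, S N = Set.univ := by
    refine Set.eq_univ_of_forall fun f => Set.mem_iUnion.2 ?_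
    obtain ⟨C, N, h⟩ := exists_norm_distribution_gaborAtom_le (A f)
    refine ⟨max ⌈C⌉₊ N, fun j => (h j).trans ?_⟩
    have hw := one_le_gaborWeight j
    have hw0 : 0 < gaborWeight j := zero_lt_one.trans_le hw
    gcongr
    · exact (Nat.le_ceil C).trans (Nat.cast_le.2 (le_max_left _ _))
    · exact le_max_right _ _
  obtain ⟨N, f₀, hf₀⟩ := nonempty_interior_of_iUnion_of_closed hSc hSU
  have hV : {h : 𝓢(Rn n, ℂ) | f₀ + h ∈ S N} ∈ 𝓝 0 := by
    have hc : Continuous fun h : 𝓢(Rn n, ℂ) => f₀ + h := by fun_prop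
    exact hc.continuousAt.preimage_mem_nhds (by simpa using mem_interior_iff_mem_nhds.1 hf₀)
  obtain ⟨M, r, hr, hrV⟩ := exists_schwartzNorm_lt_subset hV
  -- Subtracting the centre of the ball carries the uniform bound to a neighbourhood of `0`, at the
  -- price of a factor `2`.
  have hsmall : ∀ h : 𝓢(Rn n, ℂ), schwartzNorm M h < r → ∀ j,
      ‖A h (gaborAtom j)‖ ≤ 2 * N * gaborWeight j ^ N := fun h hh j => by
    have h1 : ‖A (f₀ + h) (gaborAtom j)‖ ≤ N * gaborWeight j ^ N := hrV h hh j
    have h2 : ‖A f₀ (gaborAtom j)‖ ≤ N * gaborWeight j ^ N := interior_subset hf₀ j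
    have h3 : A h (gaborAtom j) = A (f₀ + h) (gaborAtom j) - A f₀ (gaborAtom j) := by
      rw [map_add]
      exact (add_sub_cancel_left (A f₀ (gaborAtom j)) (A h (gaborAtom j))).symm
    rw [h3]
    refine (norm_sub_le _ _).trans ?_
    linarith
  obtain ⟨C, M', hC, hCM⟩ := exists_schwartzNorm_gaborAtom_le n M
  refine ⟨2 * N * (2 * (C + 1) / r), max N M', by positivity, fun i j => ?_⟩
  have hwi := one_le_gaborWeight i
  have hwj := one_le_gaborWeight j
  have hwi0 : 0 < gaborWeight i := zero_lt_one.trans_le hwi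
  have hwj0 : 0 < gaborWeight j := zero_lt_one.trans_le hwj
  -- This scales the atom into the neighbourhood of `0`; undoing the scaling produces the polynomial
  -- growth in `i`. `C + 1` avoids division by zero.
  set t : ℝ := r / (2 * (C + 1) * gaborWeight i ^ M') with ht
  have ht0 : 0 < t := by positivity
  have h1 : schwartzNorm M (t • gaborAtom i) < r := by
    rw [map_smul_eq_mul, Real.norm_of_nonneg ht0.le]
    calc t * schwartzNorm M (gaborAtom i) ≤ t * (C * gaborWeight i ^ M') :=
          mul_le_mul_of_nonneg_left (hCM i) ht0.le
      _ < t * (2 * (C + 1) * gaborWeight i ^ M') := by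
          have : 0 < gaborWeight i ^ M' := by positivity
          gcongr
          linarith
      _ = r := div_mul_cancel₀ _ (by positivity)
  have h2 := hsmall _ h1 j
  have h3 : A (t • gaborAtom i) (gaborAtom j) = (t : ℂ) * A (gaborAtom i) (gaborAtom j) := by
    have : t • gaborAtom i = (t : ℂ) • gaborAtom i := by
      ext x
      simp
    rw [this, map_smul]
    rfl
  rw [h3, norm_mul, Complex.norm_real, Real.norm_of_nonneg ht0.le, ← le_div_iff₀' ht0] at h2
  calc _ ≤ 2 * N * gaborWeight j ^ N / t := h2
    _ = 2 * N * (2 * (C + 1) / r) * gaborWeight i ^ M' * gaborWeight j ^ N := by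
        rw [ht]
        field_simp
    _ ≤ _ := by
        gcongr
        · exact le_max_right _ _
        · exact le_max_left _ _

/-- The **Schwartz kernel theorem**: existence of the kernel. -/
theorem exists_isKernel (A : 𝓢(Rn n, ℂ) →L[ℂ] 𝓢'(Rn n, ℂ)) :
    ∃ K : 𝓢'(Rn (n + n), ℂ), IsKernel A K := by
  obtain ⟨C, N, hC, hA⟩ := exists_norm_operator_gaborAtom_le A
  -- The indices are swapped because the kernel is tested against `g ⊗ f`: the first factor belongs
  -- to the output of `A`, the second to its argument.
  let a : (Fin (n + n) → ℤ) × (Fin (n + n) → ℤ) → ℂ := fun i =>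
    A (gaborAtom ((gaborIndexEquiv n).symm i).2) (gaborAtom ((gaborIndexEquiv n).symm i).1)
  have ha : ∀ i, ‖a i‖ ≤ C * gaborWeight i ^ (N + N) := fun i => by
    obtain ⟨⟨i, j⟩, rfl⟩ := (gaborIndexEquiv n).surjective i
    simp only [a, Equiv.symm_apply_apply]
    refine (hA j i).trans ?_
    rw [pow_add, mul_assoc]
    have h1 := gaborWeight_fst_le i j
    have h2 := gaborWeight_snd_le i j
    have h3 := zero_lt_one.trans_le (one_le_gaborWeight i)
    have h4 := zero_lt_one.trans_le (one_le_gaborWeight j)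
    have h5 := h3.trans_le h1
    gcongr
  obtain ⟨u, hu⟩ := exists_gaborCoef_series_functional ha
  refine ⟨ContinuousLinearMap.toPointwiseConvergenceCLM _ _ _ _ u, fun f g F hF => ?_⟩
  obtain rfl := eq_schwartzTensor hF
  have h1 := ((gaborIndexEquiv n).hasSum_iff.2 (hu (schwartzTensor g f)))
  have h2 : HasSum (fun p : ((Fin n → ℤ) × (Fin n → ℤ)) × ((Fin n → ℤ) × (Fin n → ℤ)) =>
      gaborCoef p.1 g * gaborCoef p.2 f * A (gaborAtom p.2) (gaborAtom p.1))
      (u (schwartzTensor g f)) := by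
    refine h1.congr_fun fun p => ?_
    simp only [Function.comp_apply, a, Equiv.symm_apply_apply]
    rw [← gaborCoef_gaborIndexEquiv]
  have h3 : HasSum (fun i => gaborCoef i g * A f (gaborAtom i)) (A f g) := by
    have := (distributionCLM (A f)).hasSum (hasSum_gaborCoef_smul_gaborAtom g)
    simpa only [map_smul, smul_eq_mul, distributionCLM_apply] using this
  -- The double series for `u (g ⊗ f)` is summed over the atoms of `f` first, where continuity of
  -- `A` gives `A f (gaborAtom i)`, and then over the atoms of `g`.
  refine h3.unique (h2.prod_fiberwise fun i => ?_)
  have h4 := (((PointwiseConvergenceCLM.evalCLM (RingHom.id ℂ) ℂ (gaborAtom i)).comp A).hasSum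
    (hasSum_gaborCoef_smul_gaborAtom f)).mul_left (gaborCoef i g)
  refine h4.congr_fun fun j => ?_
  rw [map_smul, smul_eq_mul, mul_assoc]
  rfl

/-- The **Schwartz kernel theorem**: uniqueness of the kernel. -/
theorem eq_of_isKernel {A : 𝓢(Rn n, ℂ) →L[ℂ] 𝓢'(Rn n, ℂ)} {K L : 𝓢'(Rn (n + n), ℂ)}
    (hK : IsKernel A K) (hL : IsKernel A L) : K = L := by
  have h : distributionCLM K = distributionCLM L := eq_of_forall_schwartzTensor fun f g =>
    (hK g f _ (schwartzTensor_pair f g)).symm.trans (hL g f _ (schwartzTensor_pair f g))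
  exact h

end KernelTheorem

/-! ### Weyl and anti-Wick symbols -/

noncomputable section WeylTransform

open FourierTransform

variable {n : ℕ}

theorem hasTemperateGrowth_pair (x : Rn n) :
    (fun y : Rn n => pair x y).HasTemperateGrowth := by
  let R : Rn n →L[ℝ] Rn (n + n) := LinearMap.toContinuousLinearMap
    { toFun := fun y => pair 0 y
      map_add' := fun y z => by rw [← pair_add, add_zero]
      map_smul' := fun c y => by rw [RingHom.id_apply, ← pair_smul, smul_zero] }
  have h : (fun y : Rn n => pair x y) = fun y => pair x 0 + R y := by
    funext y
    exact ((pair_add x 0 0 y).symm.trans (by rw [add_zero, zero_add])).symm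
  rw [h]
  exact (Function.HasTemperateGrowth.const _).add R.hasTemperateGrowth

/-- The restriction `F ↦ F(x, ·)`. -/
def sliceCLM (x : Rn n) : 𝓢(Rn (n + n), ℂ) →L[ℂ] 𝓢(Rn n, ℂ) :=
  SchwartzMap.compCLM ℂ (hasTemperateGrowth_pair x) ⟨1, 1, fun y => by
    have := norm_snd_le_norm_pair x y
    linarith⟩

theorem sliceCLM_apply (x : Rn n) (F : 𝓢(Rn (n + n), ℂ)) (y : Rn n) :
    sliceCLM x F y = F (pair x y) := rfl

theorem sliceCLM_schwartzTensor (x : Rn n) (f g : 𝓢(Rn n, ℂ)) :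
    sliceCLM x (schwartzTensor f g) = f x • g := by
  ext y
  rw [sliceCLM_apply, schwartzTensor_pair, smul_apply, smul_eq_mul]

/-- The operator is prescribed on atoms by `f ⊗ g ↦ f ⊗ 𝓕 g`. For fixed `x` and `η` both sides are
continuous in `F`, so agreement on atoms suffices. -/
theorem exists_partialFourier (n : ℕ) : ∃ W : 𝓢(Rn (n + n), ℂ) →L[ℂ] 𝓢(Rn (n + n), ℂ),
    ∀ F x η, W F (pair x η) = 𝓕 (sliceCLM x F) η := by
  let g : (Fin (n + n) → ℤ) × (Fin (n + n) → ℤ) → 𝓢(Rn (n + n), ℂ) := fun i =>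
    schwartzTensor (gaborAtom ((gaborIndexEquiv n).symm i).1)
      (𝓕 (gaborAtom ((gaborIndexEquiv n).symm i).2))
  have hg : ∀ N, ∃ (C : ℝ) (M : ℕ), 0 ≤ C ∧
      ∀ i, schwartzNorm N (g i) ≤ C * gaborWeight i ^ M := by
    intro N
    obtain ⟨C₁, M₁, hC₁, h₁⟩ := exists_schwartzNorm_gaborAtom_le n N
    obtain ⟨C₂, M₂, hC₂, h₂⟩ := ContinuousLinearMap.exists_schwartzNorm_le
      (fourierCLM ℝ 𝓢(Rn n, ℂ)) N
    obtain ⟨C₃, M₃, hC₃, h₃⟩ := exists_schwartzNorm_gaborAtom_le n M₂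
    refine ⟨2 ^ N * (2 ^ N * C₁) * (2 ^ N * (C₂ * C₃)), M₁ + M₃, by positivity, fun i => ?_⟩
    obtain ⟨⟨i, j⟩, rfl⟩ := (gaborIndexEquiv n).surjective i
    simp only [g, Equiv.symm_apply_apply]
    refine (schwartzNorm_schwartzTensor_le N _ _).trans ?_
    have hwi := zero_lt_one.trans_le (one_le_gaborWeight i)
    have hwj := zero_lt_one.trans_le (one_le_gaborWeight j)
    have hi := gaborWeight_fst_le i j
    have hj := gaborWeight_snd_le i j
    have hij := hwi.trans_le hi
    have h4 : schwartzNorm N (𝓕 (gaborAtom j)) ≤ C₂ * (C₃ * gaborWeight j ^ M₃) :=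
      (h₂ (gaborAtom j)).trans (mul_le_mul_of_nonneg_left (h₃ j) hC₂)
    have h5 := schwartzNorm_nonneg N (𝓕 (gaborAtom j))
    calc _ ≤ 2 ^ N * (2 ^ N * (C₁ * gaborWeight i ^ M₁)) *
          (2 ^ N * (C₂ * (C₃ * gaborWeight j ^ M₃))) := by
          gcongr
          exact h₁ i
      _ ≤ 2 ^ N * (2 ^ N * (C₁ * gaborWeight (gaborIndexEquiv n (i, j)) ^ M₁)) *
          (2 ^ N * (C₂ * (C₃ * gaborWeight (gaborIndexEquiv n (i, j)) ^ M₃))) := by gcongr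
      _ = _ := by
          rw [pow_add]
          ring
  obtain ⟨W, hW⟩ := exists_gaborCoef_series_operator hg
  refine ⟨W, fun F x η => ?_⟩
  have h1 := (SchwartzMap.pointEvalCLM (pair x η)).hasSum (hW F)
  have h2 := ((SchwartzMap.pointEvalCLM η).comp ((fourierCLM ℂ 𝓢(Rn n, ℂ)).comp
    (sliceCLM x))).hasSum (hasSum_gaborCoef_smul_gaborAtom F)
  refine h1.unique (h2.congr_fun fun i => ?_)
  obtain ⟨⟨i, j⟩, rfl⟩ := (gaborIndexEquiv n).surjective i
  simp only [g, Equiv.symm_apply_apply, map_smul, SchwartzMap.pointEvalCLM_apply,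
    schwartzTensor_pair, gaborAtom_gaborIndexEquiv, ContinuousLinearMap.comp_apply,
    sliceCLM_schwartzTensor, smul_eq_mul, fourierCLM_apply]

/-- The change of variables `(u, v) ↦ ((u + v)/2, u - v)`. -/
def midpointDifference (n : ℕ) : Rn (n + n) ≃L[ℝ] Rn (n + n) :=
  LinearEquiv.toContinuousLinearEquiv
    { toFun := fun z => pair ((1 / 2 : ℝ) • (pairFst z + pairSnd z)) (pairFst z - pairSnd z)
      map_add' := fun z w => by
        rw [← pair_add]
        simp only [map_add]
        congr 1 <;> module
      map_smul' := fun c z => by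
        rw [RingHom.id_apply, ← pair_smul]
        simp only [map_smul]
        congr 1 <;> module
      invFun := fun w => pair (pairFst w + (1 / 2 : ℝ) • pairSnd w)
        (pairFst w - (1 / 2 : ℝ) • pairSnd w)
      left_inv := fun z => by
        simp only [pairFst_pair, pairSnd_pair]
        conv_rhs => rw [← pair_pairFst_pairSnd z]
        congr 1 <;> module
      right_inv := fun w => by
        simp only [pairFst_pair, pairSnd_pair]
        conv_rhs => rw [← pair_pairFst_pairSnd w]
        congr 1 <;> module }

theorem midpointDifference_pair (u v : Rn n) :
    midpointDifference n (pair u v) = pair ((1 / 2 : ℝ) • (u + v)) (u - v) := by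
  change pair ((1 / 2 : ℝ) • (pairFst (pair u v) + pairSnd (pair u v)))
    (pairFst (pair u v) - pairSnd (pair u v)) = _
  rw [pairFst_pair, pairSnd_pair]

/-- The map `Φ ↦ F` in the definition of the Weyl transform is continuous on the Schwartz space. -/
theorem exists_weylTestFunction (n : ℕ) : ∃ W : 𝓢(Rn (n + n), ℂ) →L[ℂ] 𝓢(Rn (n + n), ℂ),
    ∀ (Φ : 𝓢(Rn (n + n), ℂ)) (u v : Rn n), W Φ (pair u v) =
      ∫ ξ : Rn n, Complex.exp (-(2 * Real.pi * (inner ℝ (u - v) ξ : ℝ) : ℝ) * Complex.I) *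
        Φ (pair ((1 / 2 : ℝ) • (u + v)) ξ) := by
  obtain ⟨W, hW⟩ := exists_partialFourier n
  refine ⟨(SchwartzMap.compCLMOfContinuousLinearEquiv ℂ (midpointDifference n)).comp W,
    fun Φ u v => ?_⟩
  have h : (SchwartzMap.compCLMOfContinuousLinearEquiv ℂ (midpointDifference n)).comp W Φ
      (pair u v) = W Φ (midpointDifference n (pair u v)) := rfl
  rw [h, midpointDifference_pair, hW, SchwartzMap.fourier_coe, Real.fourier_eq']
  refine MeasureTheory.integral_congr_ae (Filter.Eventually.of_forall fun ξ => ?_)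
  simp only [sliceCLM_apply, smul_eq_mul]
  rw [real_inner_comm]
  push_cast
  ring_nf

/-- Since every `Φ` has a Schwartz test function `F = W Φ`, the condition `IsWeylTransform`
determines `σ` as `K ∘ W`, and `K` is unique by the kernel theorem. -/
theorem existsUnique_isWeylSymbol (A : 𝓢(Rn n, ℂ) →L[ℂ] 𝓢'(Rn n, ℂ)) :
    ∃! σ : 𝓢'(Rn (n + n), ℂ), IsWeylSymbol A σ := by
  obtain ⟨K, hK⟩ := exists_isKernel A
  obtain ⟨W, hW⟩ := exists_weylTestFunction n
  refine ⟨ContinuousLinearMap.toPointwiseConvergenceCLM _ _ _ _ ((distributionCLM K).comp W),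
    ⟨K, hK, fun Φ F hF => ?_⟩, ?_⟩
  · have : F = W Φ := by
      ext z
      rw [← pair_pairFst_pairSnd z, hF, hW]
    rw [this]
    rfl
  · rintro τ ⟨L, hL, hτ⟩
    obtain rfl := eq_of_isKernel hL hK
    ext Φ
    exact hτ Φ (W Φ) (hW Φ)

theorem existsUnique_isAntiWickSymbol (A : 𝓢(Rn n, ℂ) →L[ℂ] 𝓢'(Rn n, ℂ)) :
    ∃! T : HeatSpace (n + n) (1 / (8 * Real.pi)) →ₗ[ℂ] ℂ, IsAntiWickSymbol A T := by
  obtain ⟨σ, hσ, hu⟩ := existsUnique_isWeylSymbol A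
  have ht : (0 : ℝ) ≤ 1 / (8 * Real.pi) := by positivity
  let e := LinearEquiv.ofBijective (toHeatSpace (n + n) (1 / (8 * Real.pi)))
    (toHeatSpace_bijective (n + n) ht)
  refine ⟨(distributionCLM σ).toLinearMap.comp e.symm.toLinearMap, ⟨σ, hσ, fun Φ => ?_⟩, ?_⟩
  · exact congrArg σ (e.symm_apply_apply Φ)
  · rintro T ⟨τ, hτ, hT⟩
    obtain rfl := hu τ hτ
    refine LinearMap.ext fun φ => ?_
    obtain ⟨Φ, rfl⟩ := e.surjective φ
    exact (hT Φ).trans (congrArg τ (e.symm_apply_apply Φ)).symm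

end WeylTransform

/-! ### The theorem -/

theorem theorem1 (n : ℕ) :
    (∀ lam mu : ℝ, 0 < lam → 0 < mu → mu < 1 / 2 →
      ∃ h : gelfandShilov n lam mu ≤ heatImage n (1 / (8 * Real.pi)),
        Continuous (gsInclusion h) ∧
        ∃ J : GelfandShilov n lam mu →L[ℂ] 𝓢(Rn n, ℂ),
          ∀ φ : GelfandShilov n lam mu,
            toHeatSpace n (1 / (8 * Real.pi)) (J φ) = gsInclusion h φ) ∧
    (∀ A : 𝓢(Rn n, ℂ) →L[ℂ] 𝓢'(Rn n, ℂ),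
      (∃! σ : 𝓢'(Rn (n + n), ℂ), IsWeylSymbol A σ) ∧
      (∃! T : HeatSpace (n + n) (1 / (8 * Real.pi)) →ₗ[ℂ] ℂ, IsAntiWickSymbol A T) ∧
      (∀ T : HeatSpace (n + n) (1 / (8 * Real.pi)) →ₗ[ℂ] ℂ, IsAntiWickSymbol A T →
        ∀ lam mu : ℝ, 0 < lam → mu < 1 / 2 →
          ∃ h : gelfandShilov (n + n) lam mu ≤ heatImage (n + n) (1 / (8 * Real.pi)),
            Continuous (fun φ : GelfandShilov (n + n) lam mu => T (gsInclusion h φ)))) := by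
  have ht : (0 : ℝ) ≤ 1 / (8 * Real.pi) := by positivity
  refine ⟨fun lam mu _ _ hmu => ?_, fun A => ⟨existsUnique_isWeylSymbol A,
    existsUnique_isAntiWickSymbol A, ?_⟩⟩
  · have h := gelfandShilov_le_heatImage n lam hmu ht
    exact ⟨h, continuous_gsInclusion hmu ht h, invHeat n lam hmu ht, toHeatSpace_invHeat hmu ht h⟩
  · rintro T ⟨σ, -, hT⟩ lam mu - hmu
    have h := gelfandShilov_le_heatImage (n + n) lam hmu ht
    refine ⟨h, ?_⟩
    -- On `S(lam, mu)` the preimage under the heat operator is explicit, so `T` becomes the Weyl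
    -- symbol composed with the continuous inverse heat operator.
    have hTσ : (fun φ : GelfandShilov (n + n) lam mu => T (gsInclusion h φ)) =
        fun φ => distributionCLM σ (invHeat (n + n) lam hmu ht φ) := by
      funext φ
      rw [← toHeatSpace_invHeat hmu ht h φ, hT, distributionCLM_apply]
    rw [hTσ]
    exact (distributionCLM σ).continuous.comp (invHeat (n + n) lam hmu ht).continuous
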